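/- **Theorem 1.** Let $1\le p\le\infty$ and let $X,Y$ be Banach spaces (both real or both complex); "operator" means continuous linear operator, and $\pi_Y:Y\to Y^{**}$ is the canonical embedding. A Banach space $E$ has the approximation property if its identity map can be approximated by finite-rank operators uniformly on every compact subset of $E$. An operator $T$ between Banach spaces $E$ and $F$ factors compactly through $\ell^p$ if $T=BA$ for some compact operators $A:E\to\ell^p$ and $B:\ell^p\to F$. For a finite family $(x_j)$ in a Banach space $E$ put $$w_p(x_j)=\sup_{f\in E^*,\,\|f\|\le1}\big\|(f(x_j))_j\big\|_{\ell^p},$$ and for a finite-rank operator $S:E\to F$ put $$K_p^0(S)=\inf\Big\{\sup_j|\alpha_j|\;w_p(x_j')\;w_{p'}(y_j)\ :\ S=\sum_{j=1}^n\alpha_j\,x_j'\otimes y_j,\ \alpha_j \text{ scalars},\ x_j'\in E^*,\ y_j\in F\Big\},\qquad \tfrac1p+\tfrac1{p'}=1.$$ Let $K_p(E,F)$ be the set of operators $E\to F$ generated by the elements of the completion of the space of finite-rank operators in the norm $K_p^0$, that is, the set of operator-norm limits of $K_p^0$-Cauchy sequences of finite-rank operators, and let $K_p^{\mathrm{reg}}(X,Y)=\{T:X\to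 Y\ :\ \pi_YT\in K_p(X,Y^{**})\}$. For every operator $T:X\to Y$, the operator $\pi_YT:X\to Y^{**}$ factors compactly through $\ell^p$ if and only if $T^{**}:X^{**}\to Y^{**}$ does. If $X^*$ or $Y^{***}$ has the approximation property, then every operator $T:X\to Y$ such that $T^{**}$ (equivalently, $\pi_YT$) factors compactly through $\ell^p$ itself factors compactly through $\ell^p$; moreover $K_p^{\mathrm{reg}}(X,Y)=K_p(X,Y)$. -/

import Mathlib

open scoped ENNReal Topology
open Filter

noncomputable section

namespace LpFactor

/-- The dual space `E*` of a normed space, with the operator norm. -/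
abbrev Dual (𝕜 E : Type*) [RCLike 𝕜] [NormedAddCommGroup E] [NormedSpace 𝕜 E] : Type _ :=
  StrongDual 𝕜 E

/-- The canonical isometric embedding `π_E : E → E**`. -/
abbrev incl (𝕜 E : Type*) [RCLike 𝕜] [NormedAddCommGroup E] [NormedSpace 𝕜 E] :
    E →L[𝕜] Dual 𝕜 (Dual 𝕜 E) :=
  NormedSpace.inclusionInDoubleDual 𝕜 E

section Basic

variable {𝕜 : Type*} [RCLike 𝕜]
variable {X : Type*} [NormedAddCommGroup X] [NormedSpace 𝕜 X]
variable {Y : Type*} [NormedAddCommGroup Y] [NormedSpace 𝕜 Y]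

/-- The (Banach space) adjoint `T* : Y* → X*`, `T* y' = y' ∘ T`. -/
def adj (T : X →L[𝕜] Y) : Dual 𝕜 Y →L[𝕜] Dual 𝕜 X :=
  ContinuousLinearMap.precomp 𝕜 T

/-- The second adjoint `T** : X** → Y**`. -/
def biadj (T : X →L[𝕜] Y) :
    Dual 𝕜 (Dual 𝕜 X) →L[𝕜] Dual 𝕜 (Dual 𝕜 Y) :=
  adj (adj T)

/-- A finite dimensional operator: a continuous linear operator with finite dimensional range. -/
def IsFiniteRank (S : X →L[𝕜] Y) : Prop :=
  FiniteDimensional 𝕜 (LinearMap.range (S : X →ₗ[𝕜] Y))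

variable (𝕜) in
/-- Grothendieck's approximation property: the identity map can be approximated by finite
dimensional operators, uniformly on every compact set. -/
def HasAP (E : Type*) [NormedAddCommGroup E] [NormedSpace 𝕜 E] : Prop :=
  ∀ K : Set E, IsCompact K → ∀ ε : ℝ, 0 < ε →
    ∃ S : E →L[𝕜] E, IsFiniteRank S ∧ ∀ x ∈ K, ‖S x - x‖ < ε

/-- `T : X → Y` factors compactly through `ℓ^p`: `T = B A` with compact operators
`A : X → ℓ^p` and `B : ℓ^p → Y`. -/
def FactorsCompactly (p : ℝ≥0∞) [Fact (1 ≤ p)] (T : X →L[𝕜] Y) : Prop :=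
  ∃ (A : X →L[𝕜] lp (fun _ : ℕ => 𝕜) p) (B : lp (fun _ : ℕ => 𝕜) p →L[𝕜] Y),
    IsCompactOperator A ∧ IsCompactOperator B ∧ T = B.comp A

variable (𝕜) in
/-- The weak `p`-norm of a finite family `x_1, …, x_n` in `X`: the supremum, over the functionals
`f` in the unit ball of `X*`, of the `ℓ^p_n`-norm of `(f x_1, …, f x_n)`
(for `p = ∞` this is the maximum norm). -/
def weakNorm (p : ℝ≥0∞) {n : ℕ} (x : Fin n → X) : ℝ :=
  sSup {r : ℝ | ∃ f : Dual 𝕜 X, ‖f‖ ≤ 1 ∧ r = ‖WithLp.toLp p (fun j => f (x j))‖}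

/-- For a finite dimensional operator `S`, the infimum of
`sup_j |α_j| · w_p(x'_j) · w_{p'}(y_j)` over all finite representations
`S = ∑_j α_j x'_j ⊗ y_j`, where `1 / p + 1 / p' = 1`. -/
def finNorm (p : ℝ≥0∞) (S : X →L[𝕜] Y) : ℝ :=
  sInf {c : ℝ | ∃ (n : ℕ) (α : Fin n → 𝕜) (x' : Fin n → Dual 𝕜 X) (y : Fin n → Y),
    S = ∑ j, α j • (x' j).smulRight (y j) ∧
    c = (⨆ j, ‖α j‖) * weakNorm 𝕜 p x' * weakNorm 𝕜 p.conjExponent y}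

variable (𝕜) in
/-- The class `K_p(X, Y)`: the image in the space of all operators of the completion of the space
`X* ⊗ Y` of finite dimensional operators in the norm `finNorm p`. An element of the completion
is given by a sequence of finite dimensional operators which is Cauchy for `finNorm p`, and the
operator that it generates is the limit of that sequence in the operator norm. -/
def Kp (p : ℝ≥0∞) (X Y : Type*) [NormedAddCommGroup X] [NormedSpace 𝕜 X]
    [NormedAddCommGroup Y] [NormedSpace 𝕜 Y] : Set (X →L[𝕜] Y) :=
  {T | ∃ S : ℕ → X →L[𝕜] Y, (∀ n, IsFiniteRank (S n)) ∧
    (∀ ε : ℝ, 0 < ε → ∃ N, ∀ m ≥ N, ∀ n ≥ N, finNorm p (S m - S n) < ε) ∧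
    Tendsto S atTop (𝓝 T)}

variable (𝕜) in
/-- The regular hull `K_p^reg(X, Y)`: all operators `T : X → Y` for which `π_Y T` belongs to
`K_p(X, Y**)`, where `π_Y : Y → Y**` is the canonical embedding. -/
def KpReg (p : ℝ≥0∞) (X Y : Type*) [NormedAddCommGroup X] [NormedSpace 𝕜 X]
    [NormedAddCommGroup Y] [NormedSpace 𝕜 Y] : Set (X →L[𝕜] Y) :=
  {T | (incl 𝕜 Y).comp T ∈
    Kp 𝕜 p X (Dual 𝕜 (Dual 𝕜 Y))}

end Basic

end LpFactor

end

/-! Everything reduces to one notion, `ApproxFactors`: `T = B A` through `ℓ^p`, where `A` and `B`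
are norm limits of their coordinate truncations. For complete `Y` it is equivalent both to compact
factorization and to membership in `K_p`. In each direction that is not immediate, `T` is written as
a series of operators that factor through some `ℓ^p_N` with geometrically decreasing norms
(`FinFactors`), and the pieces are put into disjoint blocks of `ℓ^p ≅ ℓ^p(ℕ × ℕ)`.

If the truncations of `A` converge in norm, its second adjoint still takes values in `ℓ^p`. This
extension of `A` to `X**`, followed by `B`, is `T**` whenever `B A = π_Y T`; conversely `T** π_X =
π_Y T`.

To descend from `Y**` to `Y`, it suffices to find finite rank operators `S : X → Y` for which `π_Y S
- B trunc_N A` has arbitrarily small factorization norm for large `N`. Successive differences of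
such `S` are then small as operators into `Y**`, and `FinFactors.of_incl_comp`, a form of local
reflexivity proved by Helly's theorem, makes them small as operators into `Y`, up to a factor 5.
Their series factors `T`.

If `X*` has the approximation property, the compact operator `A*` is approximated by finite rank
operators on `X*`; the extension of `B A` to `X**` takes values in `π_Y Y`, so the resulting
operators land in `Y`. If `Y***` has it, let `E = Y** / π_Y Y`. The dual of `E` is a complemented
subspace of `Y***`, hence `E*`, and then `E` by `HasAP.of_dual`, has the approximation property. The
complementation also lifts operators `ℓ^p_N → E` to `Y**` with control of norms
(`exists_colOp_lift`). So `B` can be corrected, up to a small error and a finite rank term that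
vanishes on the range of `π_Y T`, to an operator with values in `π_Y Y`. -/

noncomputable section

namespace LpFactor

/-! ### Coordinate operators on `ℓ^p`: truncations and blocks -/

section SequenceSpaces

variable {𝕜 : Type*} [RCLike 𝕜] {p : ℝ≥0∞} [hp1 : Fact (1 ≤ p)] {ι κ : Type*}

/-- The partial maps `κ → ι` along which functions in `ℓ^p` may be pulled back: those that are
injective where they are defined, and all of them if `p = ∞`. -/
def PullAdmissible (p : ℝ≥0∞) (σ : κ → Option ι) : Prop :=
  p = ∞ ∨ ∀ k k' i, σ k = some i → σ k' = some i → k = k'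

/-- The function `x ∘ σ`, extended by zero to the points where `σ` is undefined. -/
def pullFun (σ : κ → Option ι) (x : ι → 𝕜) (k : κ) : 𝕜 := (σ k).elim 0 x

omit hp1 in
lemma sum_pullFun_le (σ : κ → Option ι) (hσ : ∀ k k' i, σ k = some i → σ k' = some i → k = k')
    (hp : 0 < p.toReal) (x : lp (fun _ : ι => 𝕜) p) (s : Finset κ) :
    ∑ k ∈ s, ‖pullFun σ x k‖ ^ p.toReal ≤ ‖x‖ ^ p.toReal := by
  classical
  have h1 : ∑ k ∈ s, ‖pullFun σ x k‖ ^ p.toReal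
      = ∑ k ∈ s with (σ k).isSome, ‖pullFun σ x k‖ ^ p.toReal := by
    rw [Finset.sum_filter]
    refine Finset.sum_congr rfl fun k _ => ?_
    cases h : σ k <;> simp [pullFun, h, hp.ne']
  rw [h1]
  refine le_trans (le_of_eq ?_) (lp.sum_rpow_le_norm_rpow hp x (s.biUnion fun k => (σ k).toFinset))
  refine Finset.sum_bij (fun k hk => (σ k).get (Finset.mem_filter.1 hk).2) ?_ ?_ ?_ ?_
  · intro k hk
    refine Finset.mem_biUnion.2 ⟨k, (Finset.mem_filter.1 hk).1, ?_⟩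
    simp
  · intro k hk k' hk' h
    exact hσ k k' _ (Option.some_get _).symm ((Option.some_get _).symm.trans (congrArg some h.symm))
  · intro i hi
    obtain ⟨k, hk, hki⟩ := Finset.mem_biUnion.1 hi
    simp only [Option.mem_toFinset, Option.mem_def] at hki
    exact ⟨k, Finset.mem_filter.2 ⟨hk, by simp [hki]⟩, by simp [hki]⟩
  · intro k hk
    obtain ⟨i, hi⟩ := Option.isSome_iff_exists.1 (Finset.mem_filter.1 hk).2
    simp [pullFun, hi]

lemma memℓp_pullFun {σ : κ → Option ι} (hσ : PullAdmissible p σ) (x : lp (fun _ : ι => 𝕜) p) :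
    Memℓp (E := fun _ : κ => 𝕜) (pullFun σ x) p := by
  rcases eq_or_ne p ∞ with rfl | hp
  · refine memℓp_infty ⟨‖x‖, ?_⟩
    rintro _ ⟨k, rfl⟩
    cases h : σ k <;> simp [pullFun, h, lp.norm_apply_le_norm ENNReal.top_ne_zero]
  · exact memℓp_gen' fun s => sum_pullFun_le σ (hσ.resolve_left hp)
      (ENNReal.toReal_pos (zero_lt_one.trans_le hp1.out).ne' hp) x s

/-- Pull-back of elements of `ℓ^p` along a partial map. -/
def pull (σ : κ → Option ι) (hσ : PullAdmissible p σ) :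
    lp (fun _ : ι => 𝕜) p →L[𝕜] lp (fun _ : κ => 𝕜) p :=
  LinearMap.mkContinuous
    { toFun := fun x => ⟨pullFun σ x, memℓp_pullFun hσ x⟩
      map_add' := fun x y => by
        ext k
        change pullFun σ (x + y : ι → 𝕜) k = pullFun σ x k + pullFun σ y k
        cases h : σ k <;> simp [pullFun, h]
      map_smul' := fun c x => by
        ext k
        change pullFun σ (c • x : ι → 𝕜) k = c • pullFun σ x k
        cases h : σ k <;> simp [pullFun, h] } 1 (fun x => by
    rw [one_mul]
    rcases eq_or_ne p ∞ with rfl | hp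
    · refine lp.norm_le_of_forall_le (norm_nonneg _) fun k => ?_
      change ‖pullFun σ x k‖ ≤ ‖x‖
      cases h : σ k <;> simp [pullFun, h, lp.norm_apply_le_norm ENNReal.top_ne_zero]
    · have hp0 := ENNReal.toReal_pos (zero_lt_one.trans_le hp1.out).ne' hp
      exact lp.norm_le_of_forall_sum_le hp0 (norm_nonneg _) fun s =>
        sum_pullFun_le σ (hσ.resolve_left hp) hp0 x s)

lemma norm_pull_le (σ : κ → Option ι) (hσ : PullAdmissible p σ) :
    ‖(pull σ hσ : lp (fun _ : ι => 𝕜) p →L[𝕜] lp (fun _ : κ => 𝕜) p)‖ ≤ 1 :=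
  LinearMap.mkContinuous_norm_le _ zero_le_one _

variable (𝕜 p) in
/-- The coordinate projection of `ℓ^p` onto the span of the first `N` unit vectors. -/
def trunc (N : ℕ) : lp (fun _ : ℕ => 𝕜) p →L[𝕜] lp (fun _ : ℕ => 𝕜) p :=
  pull (fun k => if k < N then some k else none) (Or.inr (by
    intro k k' i h h'
    dsimp only at h h'
    split_ifs at h h'
    simp_all))

lemma trunc_apply (N : ℕ) (x : lp (fun _ : ℕ => 𝕜) p) (k : ℕ) :
    trunc 𝕜 p N x k = if k < N then x k else 0 := by
  change (if k < N then some k else none).elim 0 (x : ℕ → 𝕜) = _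
  split_ifs <;> rfl

lemma norm_trunc_le (N : ℕ) : ‖trunc 𝕜 p N‖ ≤ 1 := norm_pull_le _ _

lemma trunc_eq_self {N : ℕ} {x : lp (fun _ : ℕ => 𝕜) p} (h : ∀ k, N ≤ k → x k = 0) :
    trunc 𝕜 p N x = x := by
  ext k
  rw [trunc_apply]
  split_ifs with h'
  · rfl
  · exact (h k (not_lt.1 h')).symm

lemma trunc_eq_sum (N : ℕ) (x : lp (fun _ : ℕ => 𝕜) p) :
    trunc 𝕜 p N x = ∑ j ∈ Finset.range N, x j • lp.single p j (1 : 𝕜) := by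
  ext k
  rw [trunc_apply, lp.coeFn_sum, Finset.sum_apply]
  simp only [lp.coeFn_smul, Pi.smul_apply, lp.single_apply, smul_eq_mul, Pi.single_apply,
    mul_ite, mul_one, mul_zero]
  rw [Finset.sum_ite_eq]
  simp

/-- The inclusion of `ℓ^p` as the `m`-th block of `ℓ^p ≅ ℓ^p(ℕ × ℕ)`. -/
def blockIncl (m : ℕ) : lp (fun _ : ℕ => 𝕜) p →L[𝕜] lp (fun _ : ℕ => 𝕜) p :=
  pull (fun k => if k.unpair.1 = m then some k.unpair.2 else none) (Or.inr (by
    intro k k' i h h'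
    dsimp only at h h'
    split_ifs at h h' with h1 h2
    simp only [Option.some.injEq] at h h'
    rw [← Nat.pair_unpair k, ← Nat.pair_unpair k', h1, h2, h, h']))

/-- The projection of `ℓ^p ≅ ℓ^p(ℕ × ℕ)` onto its `m`-th block. -/
def blockProj (m : ℕ) : lp (fun _ : ℕ => 𝕜) p →L[𝕜] lp (fun _ : ℕ => 𝕜) p :=
  pull (fun k => some (Nat.pair m k)) (Or.inr (by
    intro k k' i h h'
    have := h.trans h'.symm
    simpa using this))

lemma norm_blockIncl_le (m : ℕ) : ‖(blockIncl m : lp (fun _ : ℕ => 𝕜) p →L[𝕜] _)‖ ≤ 1 :=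
  norm_pull_le _ _

lemma norm_blockProj_le (m : ℕ) : ‖(blockProj m : lp (fun _ : ℕ => 𝕜) p →L[𝕜] _)‖ ≤ 1 :=
  norm_pull_le _ _

lemma blockIncl_apply (m : ℕ) (x : lp (fun _ : ℕ => 𝕜) p) (k : ℕ) :
    blockIncl m x k = if k.unpair.1 = m then x k.unpair.2 else 0 := by
  change (if k.unpair.1 = m then some k.unpair.2 else none).elim 0 (x : ℕ → 𝕜) = _
  split_ifs <;> rfl

lemma blockProj_apply (m : ℕ) (x : lp (fun _ : ℕ => 𝕜) p) (k : ℕ) :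
    blockProj m x k = x (Nat.pair m k) := rfl

lemma blockProj_blockIncl (m n : ℕ) (x : lp (fun _ : ℕ => 𝕜) p) :
    blockProj m (blockIncl n x) = if m = n then x else 0 := by
  ext k
  rw [blockProj_apply, blockIncl_apply, Nat.unpair_pair]
  split_ifs <;> simp

omit hp1 in
lemma pullAdmissible_inclFin (N : ℕ) :
    PullAdmissible p (fun k => if h : k < N then some (⟨k, h⟩ : Fin N) else none) :=
  Or.inr (by
    intro k k' i h h'
    dsimp only at h h'
    split_ifs at h h'
    simp only [Option.some.injEq] at h h'
    simpa using congrArg Fin.val (h.trans h'.symm))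

variable (𝕜 p) in
/-- The inclusion of `ℓ^p_N` into `ℓ^p`. -/
def inclFin (N : ℕ) : PiLp p (fun _ : Fin N => 𝕜) →L[𝕜] lp (fun _ : ℕ => 𝕜) p :=
  (pull _ (pullAdmissible_inclFin N)).comp
    (lpPiLpₗᵢ (fun _ : Fin N => 𝕜) 𝕜).symm.toContinuousLinearEquiv.toContinuousLinearMap

variable (𝕜 p) in
/-- The projection of `ℓ^p` onto `ℓ^p_N`. -/
def projFin (N : ℕ) : lp (fun _ : ℕ => 𝕜) p →L[𝕜] PiLp p (fun _ : Fin N => 𝕜) :=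
  (lpPiLpₗᵢ (fun _ : Fin N => 𝕜) 𝕜).toContinuousLinearEquiv.toContinuousLinearMap.comp
    (pull (fun k => some (k : ℕ)) (Or.inr (by
      intro k k' i h h'
      exact Fin.ext (by simpa using h.trans h'.symm))))

lemma inclFin_apply (N : ℕ) (x : PiLp p (fun _ : Fin N => 𝕜)) (k : ℕ) :
    inclFin 𝕜 p N x k = if h : k < N then x ⟨k, h⟩ else 0 := by
  change (if h : k < N then some (⟨k, h⟩ : Fin N) else none).elim 0 (x : Fin N → 𝕜) = _
  split_ifs <;> rfl

lemma projFin_apply (N : ℕ) (x : lp (fun _ : ℕ => 𝕜) p) (k : Fin N) :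
    projFin 𝕜 p N x k = x k := rfl

lemma norm_inclFin_apply_le (N : ℕ) (x : PiLp p (fun _ : Fin N => 𝕜)) :
    ‖inclFin 𝕜 p N x‖ ≤ ‖x‖ := by
  refine (ContinuousLinearMap.le_of_opNorm_le _ (norm_pull_le _ (pullAdmissible_inclFin N)) _).trans ?_
  rw [one_mul]
  exact ((lpPiLpₗᵢ (fun _ : Fin N => 𝕜) 𝕜).symm.norm_map x).le

lemma norm_projFin_apply_le (N : ℕ) (x : lp (fun _ : ℕ => 𝕜) p) :
    ‖projFin 𝕜 p N x‖ ≤ ‖x‖ := by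
  refine ((lpPiLpₗᵢ (fun _ : Fin N => 𝕜) 𝕜).norm_map _).le.trans ?_
  exact (ContinuousLinearMap.le_of_opNorm_le _ (norm_pull_le _ _) _).trans (one_mul _).le

lemma norm_inclFin_le (N : ℕ) : ‖inclFin 𝕜 p N‖ ≤ 1 :=
  ContinuousLinearMap.opNorm_le_bound _ zero_le_one fun x => by
    simpa using norm_inclFin_apply_le N x

lemma norm_projFin_le (N : ℕ) : ‖projFin 𝕜 p N‖ ≤ 1 :=
  ContinuousLinearMap.opNorm_le_bound _ zero_le_one fun x => by
    simpa using norm_projFin_apply_le N x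

lemma inclFin_comp_projFin (N : ℕ) : (inclFin 𝕜 p N).comp (projFin 𝕜 p N) = trunc 𝕜 p N := by
  ext x k
  rw [ContinuousLinearMap.comp_apply, inclFin_apply, trunc_apply]
  split_ifs <;> rfl

lemma projFin_inclFin (N : ℕ) (x : PiLp p (fun _ : Fin N => 𝕜)) :
    projFin 𝕜 p N (inclFin 𝕜 p N x) = x := by
  ext k
  rw [projFin_apply, inclFin_apply]
  simp

lemma inclFin_single (N : ℕ) (j : Fin N) :
    inclFin 𝕜 p N (WithLp.toLp p (Pi.single j 1)) = lp.single p (j : ℕ) (1 : 𝕜) := by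
  ext k
  rw [inclFin_apply, lp.single_apply]
  split_ifs with h
  · simp [Pi.single_apply, Fin.ext_iff]
  · rw [Pi.single_eq_of_ne]
    have := j.2
    omega

omit hp1 in
lemma toLp_eq_sum {n : ℕ} (c : PiLp p (fun _ : Fin n => 𝕜)) :
    c = ∑ j, c j • (WithLp.toLp p (Pi.single j 1) : PiLp p (fun _ : Fin n => 𝕜)) := by
  ext k
  simp [Pi.single_apply]

end SequenceSpaces

/-! ### Hölder duality for `ℓ^p_n` -/

section FiniteDuality

variable {𝕜 : Type*} [RCLike 𝕜] {p q : ℝ≥0∞} {n : ℕ}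

lemma norm_dual_pairing_le (hpq : p.HolderConjugate q) (c : PiLp p (fun _ : Fin n => 𝕜))
    (d : PiLp q (fun _ : Fin n => 𝕜)) : ‖∑ j, c j * d j‖ ≤ ‖c‖ * ‖d‖ := by
  have key : ∑ j, ‖c j‖ * ‖d j‖ ≤ ‖c‖ * ‖d‖ := by
    rcases eq_or_ne p ∞ with rfl | hp
    · have hq : q = 1 := hpq.conjExponent_eq.symm.trans (by simp [ENNReal.conjExponent])
      subst hq
      have : ‖d‖ = ∑ j, ‖d j‖ := by simpa using PiLp.norm_eq_of_L1 d
      rw [this, Finset.mul_sum]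
      gcongr with j
      exact PiLp.norm_apply_le c j
    rcases eq_or_ne q ∞ with rfl | hq
    · have hp1 : p = 1 := hpq.symm.conjExponent_eq.symm.trans (by simp [ENNReal.conjExponent])
      subst hp1
      have : ‖c‖ = ∑ j, ‖c j‖ := by simpa using PiLp.norm_eq_of_L1 c
      rw [this, Finset.sum_mul]
      gcongr with j
      exact PiLp.norm_apply_le d j
    have h := hpq.toReal (by
      rw [← ENNReal.toReal_one]
      exact (ENNReal.toReal_lt_toReal (by simp) hp).2
        ((ENNReal.HolderConjugate.lt_top_iff_one_lt q p).1 hq.lt_top))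
    rw [PiLp.norm_eq_sum h.pos c, PiLp.norm_eq_sum h.symm.pos d]
    refine (Real.inner_le_Lp_mul_Lq_of_nonneg _ h (fun j _ => norm_nonneg _)
      (fun j _ => norm_nonneg _))
  refine (norm_sum_le _ _).trans ?_
  simpa only [norm_mul] using key

lemma exists_norm_le_one_mul_eq_norm (z : 𝕜) : ∃ u : 𝕜, ‖u‖ ≤ 1 ∧ u * z = (‖z‖ : 𝕜) := by
  obtain ⟨g, hg, h⟩ := exists_dual_vector'' 𝕜 z
  refine ⟨g 1, by simpa using g.le_of_opNorm_le hg 1, ?_⟩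
  rw [← h, mul_comm, ← smul_eq_mul, ← map_smul, smul_eq_mul, mul_one]

/-- Test on the extremal vector of Hölder's inequality: the phases `u (d j)` if `p = ∞`, unit
vectors if `q = ∞`, and `|d_j|^(q-1) u (d j)` otherwise. The last gives `D ≤ C D^(1/p)` for `D = ∑
|d_j|^q`, and `D^(1/p)` cancels. -/
lemma norm_le_of_dual_pairing_le (hpq : p.HolderConjugate q) (d : PiLp q (fun _ : Fin n => 𝕜))
    {C : ℝ} (hC : 0 ≤ C)
    (h : ∀ c : PiLp p (fun _ : Fin n => 𝕜), ‖∑ j, c j * d j‖ ≤ C * ‖c‖) : ‖d‖ ≤ C := by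
  choose u hu hud using fun z : 𝕜 => exists_norm_le_one_mul_eq_norm z
  rcases eq_or_ne p ∞ with rfl | hp
  · have hq : q = 1 := hpq.conjExponent_eq.symm.trans (by simp [ENNReal.conjExponent])
    subst hq
    have h1 : ‖d‖ = ∑ j, ‖d j‖ := by simpa using PiLp.norm_eq_of_L1 d
    have h2 := h (WithLp.toLp ∞ fun j => u (d j))
    simp only [hud, ← RCLike.ofReal_sum] at h2
    rw [RCLike.norm_ofReal, abs_of_nonneg (by positivity), ← h1] at h2
    refine h2.trans (mul_le_of_le_one_right hC ?_)
    rw [PiLp.norm_toLp, pi_norm_le_iff_of_nonneg zero_le_one]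
    exact fun j => hu _
  rcases eq_or_ne q ∞ with rfl | hq
  · have hp1 : p = 1 := hpq.symm.conjExponent_eq.symm.trans (by simp [ENNReal.conjExponent])
    subst hp1
    have : d = WithLp.toLp ∞ (fun j => d j) := rfl
    rw [this, PiLp.norm_toLp, pi_norm_le_iff_of_nonneg hC]
    intro j
    have h2 := h (WithLp.toLp 1 (Pi.single j 1))
    simpa [Pi.single_apply] using h2
  have hr := hpq.toReal (by
      rw [← ENNReal.toReal_one]
      exact (ENNReal.toReal_lt_toReal (by simp) hp).2
        ((ENNReal.HolderConjugate.lt_top_iff_one_lt q p).1 hq.lt_top))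
  set P := p.toReal
  set Q := q.toReal
  rw [PiLp.norm_eq_sum hr.symm.pos d]
  set D := ∑ j, ‖d j‖ ^ Q with hD
  have hD0 : 0 ≤ D := by positivity
  have h2 := h (WithLp.toLp p fun j => ((‖d j‖ ^ (Q - 1) : ℝ) : 𝕜) * u (d j))
  have h3 : ∀ j, ‖d j‖ ^ (Q - 1) * ‖d j‖ = ‖d j‖ ^ Q := fun j => by
    rcases eq_or_ne ‖d j‖ 0 with h0 | h0
    · simp [h0, hr.symm.ne_zero]
    · rw [Real.rpow_sub_one h0, div_mul_cancel₀ _ h0]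
  have h4 : (∑ j, ((‖d j‖ ^ (Q - 1) : ℝ) : 𝕜) * u (d j) * d j) = ((D : ℝ) : 𝕜) := by
    rw [hD, RCLike.ofReal_sum]
    refine Finset.sum_congr rfl fun j _ => ?_
    rw [mul_assoc, hud, ← RCLike.ofReal_mul, h3]
  simp only [h4] at h2
  rw [RCLike.norm_ofReal, abs_of_nonneg hD0, PiLp.norm_eq_sum hr.pos] at h2
  have h5 : ∑ j, ‖((‖d j‖ ^ (Q - 1) : ℝ) : 𝕜) * u (d j)‖ ^ P ≤ D := by
    rw [hD]
    refine Finset.sum_le_sum fun j _ => ?_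
    have : ‖d j‖ ^ Q = (‖d j‖ ^ (Q - 1)) ^ P := by
      rw [← Real.rpow_mul (norm_nonneg _), hr.symm.sub_one_mul_conj]
    rw [this, norm_mul, RCLike.norm_ofReal, abs_of_nonneg (by positivity)]
    refine Real.rpow_le_rpow (by positivity) (mul_le_of_le_one_right (by positivity) (hu _))
      hr.nonneg
  have h6 : D ≤ C * D ^ (1 / P) :=
    h2.trans (mul_le_mul_of_nonneg_left
      (Real.rpow_le_rpow (by positivity) h5 (by have := hr.pos; positivity)) hC)
  rcases hD0.eq_or_lt with h0 | h0
  · rw [← h0, Real.zero_rpow (by have := hr.symm.pos; positivity)]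
    exact hC
  · have h7 : D = D ^ (1 / Q) * D ^ (1 / P) := by
      rw [← Real.rpow_add h0, one_div, one_div, hr.symm.inv_add_inv_eq_one, Real.rpow_one]
    have h8 : 0 < D ^ (1 / P) := by positivity
    exact le_of_mul_le_mul_right (h7 ▸ h6) h8

lemma norm_mul_le (hp1 : 1 ≤ p) (a c : Fin n → 𝕜) :
    ‖(WithLp.toLp p (fun j => a j * c j) : PiLp p (fun _ : Fin n => 𝕜))‖
      ≤ (⨆ j, ‖a j‖) * ‖(WithLp.toLp p c : PiLp p (fun _ : Fin n => 𝕜))‖ := by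
  have ha : ∀ j, ‖a j‖ ≤ ⨆ j, ‖a j‖ := fun j =>
    le_ciSup (f := fun j => ‖a j‖) (Set.finite_range _).bddAbove j
  have ha0 : 0 ≤ ⨆ j, ‖a j‖ := Real.iSup_nonneg fun _ => norm_nonneg _
  rcases eq_or_ne p ∞ with rfl | hp
  · rw [PiLp.norm_toLp, PiLp.norm_toLp, pi_norm_le_iff_of_nonneg (by positivity)]
    intro j
    rw [norm_mul]
    exact mul_le_mul (ha j) (norm_le_pi_norm c j) (norm_nonneg _) ha0
  · have hp0 := ENNReal.toReal_pos (zero_lt_one.trans_le hp1).ne' hp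
    rw [PiLp.norm_eq_sum hp0, PiLp.norm_eq_sum hp0]
    have h1 : (⨆ j, ‖a j‖) = ((⨆ j, ‖a j‖) ^ p.toReal) ^ (1 / p.toReal) := by
      rw [one_div, Real.rpow_rpow_inv ha0 hp0.ne']
    rw [h1, ← Real.mul_rpow (by positivity) (by positivity), Finset.mul_sum]
    refine Real.rpow_le_rpow (by positivity) (Finset.sum_le_sum fun j _ => ?_) (by positivity)
    dsimp only
    rw [norm_mul, Real.mul_rpow (norm_nonneg _) (norm_nonneg _)]
    gcongr
    exact ha j

lemma norm_toLp_le_sum [Fact (1 ≤ p)] (c : Fin n → 𝕜) :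
    ‖(WithLp.toLp p c : PiLp p (fun _ : Fin n => 𝕜))‖ ≤ ∑ j, ‖c j‖ := by
  conv_lhs => rw [toLp_eq_sum (WithLp.toLp p c)]
  refine (norm_sum_le _ _).trans (Finset.sum_le_sum fun j _ => ?_)
  rw [norm_smul]
  refine mul_le_of_le_one_right (norm_nonneg _) ?_
  simp

end FiniteDuality

/-! ### Weak norms as operator norms -/

section WeakNorm

variable {𝕜 : Type*} [RCLike 𝕜] {p : ℝ≥0∞} [hp1 : Fact (1 ≤ p)] {n : ℕ}
variable {X : Type*} [NormedAddCommGroup X] [NormedSpace 𝕜 X]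
variable {Y : Type*} [NormedAddCommGroup Y] [NormedSpace 𝕜 Y]

lemma bddAbove_weakNorm (x : Fin n → X) :
    BddAbove {r : ℝ | ∃ f : Dual 𝕜 X, ‖f‖ ≤ 1 ∧ r = ‖WithLp.toLp p (fun j => f (x j))‖} := by
  refine ⟨∑ j, ‖x j‖, ?_⟩
  rintro r ⟨f, hf, rfl⟩
  refine (norm_toLp_le_sum _).trans (Finset.sum_le_sum fun j _ => ?_)
  simpa using f.le_of_opNorm_le hf (x j)

lemma le_weakNorm (x : Fin n → X) {f : Dual 𝕜 X} (hf : ‖f‖ ≤ 1) :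
    ‖WithLp.toLp p (fun j => f (x j))‖ ≤ weakNorm 𝕜 p x :=
  le_csSup (bddAbove_weakNorm x) ⟨f, hf, rfl⟩

omit hp1 in
lemma weakNorm_le {x : Fin n → X} {C : ℝ}
    (h : ∀ f : Dual 𝕜 X, ‖f‖ ≤ 1 → ‖WithLp.toLp p (fun j => f (x j))‖ ≤ C) :
    weakNorm 𝕜 p x ≤ C := by
  refine csSup_le ⟨_, (0 : Dual 𝕜 X), by rw [norm_zero]; exact zero_le_one, rfl⟩ ?_
  rintro r ⟨f, hf, rfl⟩
  exact h f hf

variable (p) in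
lemma weakNorm_nonneg (x : Fin n → X) : 0 ≤ weakNorm 𝕜 p x :=
  Real.sSup_nonneg (by
    rintro r ⟨f, -, rfl⟩
    exact norm_nonneg (WithLp.toLp p fun j => f (x j) : PiLp p fun _ : Fin n => 𝕜))

instance one_le_conjExponent : Fact (1 ≤ p.conjExponent) :=
  ⟨ENNReal.HolderConjugate.one_le _ p⟩

variable (p) in
/-- The operator `x ↦ (x'_j x)_j` from `X` to `ℓ^p_n`. -/
def rowOp (x' : Fin n → Dual 𝕜 X) : X →L[𝕜] PiLp p (fun _ : Fin n => 𝕜) :=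
  (PiLp.continuousLinearEquiv p 𝕜 (fun _ : Fin n => 𝕜)).symm.toContinuousLinearMap.comp
    (ContinuousLinearMap.pi x')

variable (p) in
/-- The operator `c ↦ ∑ j, c_j y_j` from `ℓ^p_n` to `Y`. -/
def colOp (y : Fin n → Y) : PiLp p (fun _ : Fin n => 𝕜) →L[𝕜] Y :=
  ∑ j, (PiLp.proj p (fun _ : Fin n => 𝕜) j : PiLp p (fun _ : Fin n => 𝕜) →L[𝕜] 𝕜).smulRight (y j)

omit hp1 in
lemma rowOp_apply (x' : Fin n → Dual 𝕜 X) (x : X) :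
    rowOp p x' x = WithLp.toLp p (fun j => x' j x) := rfl

omit hp1 in
lemma colOp_apply (y : Fin n → Y) (c : PiLp p (fun _ : Fin n => 𝕜)) :
    colOp p y c = ∑ j, c j • y j := by
  simp [colOp]

omit hp1 in
lemma eq_colOp (B : PiLp p (fun _ : Fin n => 𝕜) →L[𝕜] Y) :
    B = colOp p (fun j => B (WithLp.toLp p (Pi.single j 1))) := by
  ext c
  rw [colOp_apply]
  conv_lhs => rw [toLp_eq_sum c]
  simp only [map_sum, map_smul]

/-- Evaluations at points of the unit ball of `X` are among the functionals tested by the weak norm.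
With the next three lemmas, the weak norms are exactly operator norms to and from `ℓ^p_n`, so
`finNorm` measures factorizations through `ℓ^p_n`. -/
lemma norm_rowOp_le (x' : Fin n → Dual 𝕜 X) : ‖rowOp p x'‖ ≤ weakNorm 𝕜 p x' := by
  refine ContinuousLinearMap.opNorm_le_of_unit_norm (weakNorm_nonneg p _) fun x hx => ?_
  have := le_weakNorm (p := p) x' (f := incl 𝕜 X x)
    ((NormedSpace.double_dual_bound 𝕜 X x).trans hx.le)
  exact this

/-- The weak norm tests on the ball of `X**`, the operator norm only on that of `X`. Nothing is
lost: a norming functional `g` on `ℓ^p_n` turns `(F x'_j)` into `F` applied to `g ∘ rowOp = ∑ g(e_j)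
x'_j`. -/
lemma weakNorm_le_norm_rowOp (x' : Fin n → Dual 𝕜 X) : weakNorm 𝕜 p x' ≤ ‖rowOp p x'‖ := by
  refine weakNorm_le fun F hF => ?_
  obtain ⟨g, hg, h⟩ := exists_dual_vector'' 𝕜
    (WithLp.toLp p (fun j => F (x' j)) : PiLp p (fun _ : Fin n => 𝕜))
  have h1 : g (WithLp.toLp p (fun j => F (x' j))) = F (g.comp (rowOp p x')) := by
    conv_lhs => rw [toLp_eq_sum (WithLp.toLp p (fun j => F (x' j)))]
    have : g.comp (rowOp p x')
        = ∑ j, g (WithLp.toLp p (Pi.single j 1)) • x' j := by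
      ext x
      rw [ContinuousLinearMap.comp_apply, rowOp_apply, toLp_eq_sum (WithLp.toLp p fun j => x' j x)]
      simp [mul_comm]
    rw [this]
    simp [mul_comm]
  have h2 : ‖g (WithLp.toLp p (fun j => F (x' j)))‖ ≤ ‖rowOp p x'‖ := by
    rw [h1]
    calc ‖F (g.comp (rowOp p x'))‖ ≤ 1 * ‖g.comp (rowOp p x')‖ := F.le_of_opNorm_le hF _
      _ ≤ 1 * (1 * ‖rowOp p x'‖) := by
        gcongr
        exact (ContinuousLinearMap.opNorm_comp_le _ _).trans (by gcongr)
      _ = _ := by ring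
  rw [h, RCLike.norm_ofReal, abs_of_nonneg (norm_nonneg _)] at h2
  exact h2

lemma norm_colOp_le (y : Fin n → Y) :
    ‖colOp (𝕜 := 𝕜) p y‖ ≤ weakNorm 𝕜 p.conjExponent y := by
  have hpq : p.HolderConjugate p.conjExponent := inferInstance
  refine ContinuousLinearMap.opNorm_le_bound _ (weakNorm_nonneg _ _) fun c => ?_
  obtain ⟨g, hg, h⟩ := exists_dual_vector'' 𝕜 (colOp p y c)
  have h2 : ‖g (colOp p y c)‖ ≤ ‖c‖ * ‖WithLp.toLp p.conjExponent (fun j => g (y j))‖ := by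
    have := norm_dual_pairing_le hpq c (WithLp.toLp p.conjExponent (fun j => g (y j)))
    simpa [colOp_apply] using this
  rw [h, RCLike.norm_ofReal, abs_of_nonneg (norm_nonneg _)] at h2
  refine h2.trans ?_
  rw [mul_comm]
  gcongr
  exact le_weakNorm y hg

lemma weakNorm_le_norm_colOp (y : Fin n → Y) :
    weakNorm 𝕜 p.conjExponent y ≤ ‖colOp (𝕜 := 𝕜) p y‖ := by
  have hpq : p.HolderConjugate p.conjExponent := inferInstance
  refine weakNorm_le fun g hg => ?_
  refine norm_le_of_dual_pairing_le hpq _ (norm_nonneg _) fun c => ?_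
  have : ∑ j, c j * g (y j) = g (colOp p y c) := by simp [colOp_apply]
  dsimp only
  rw [this]
  refine (g.le_of_opNorm_le hg _).trans ?_
  rw [one_mul]
  exact ContinuousLinearMap.le_opNorm _ _

end WeakNorm

/-! ### Finite rank operators -/

section FiniteRank

variable {𝕜 : Type*} [RCLike 𝕜]
variable {X : Type*} [NormedAddCommGroup X] [NormedSpace 𝕜 X]
variable {Y : Type*} [NormedAddCommGroup Y] [NormedSpace 𝕜 Y]
variable {Z : Type*} [NormedAddCommGroup Z] [NormedSpace 𝕜 Z]

lemma opNorm_comp_le_of_le {f : Y →L[𝕜] Z} {g : X →L[𝕜] Y} {a b : ℝ} (hf : ‖f‖ ≤ a)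
    (hg : ‖g‖ ≤ b) : ‖f.comp g‖ ≤ a * b :=
  (f.opNorm_comp_le g).trans (mul_le_mul hf hg (norm_nonneg _) ((norm_nonneg _).trans hf))

lemma opNorm_comp_le_right {f : Y →L[𝕜] Z} (hf : ‖f‖ ≤ 1) (g : X →L[𝕜] Y) :
    ‖f.comp g‖ ≤ ‖g‖ :=
  (opNorm_comp_le_of_le hf le_rfl).trans (one_mul _).le

lemma opNorm_comp_le_left (f : Y →L[𝕜] Z) {g : X →L[𝕜] Y} (hg : ‖g‖ ≤ 1) :
    ‖f.comp g‖ ≤ ‖f‖ :=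
  (opNorm_comp_le_of_le le_rfl hg).trans (mul_one _).le

lemma IsFiniteRank.of_mem {S : X →L[𝕜] Y} (V : Submodule 𝕜 Y) [FiniteDimensional 𝕜 V]
    (h : ∀ x, S x ∈ V) : IsFiniteRank S := by
  refine Submodule.finiteDimensional_of_le (S₂ := V) ?_
  rintro _ ⟨x, rfl⟩
  exact h x

lemma isFiniteRank_sum_smulRight {n : ℕ} (v : Fin n → Dual 𝕜 X) (y : Fin n → Y) :
    IsFiniteRank (∑ j, (v j).smulRight (y j)) := by
  have : FiniteDimensional 𝕜 (Submodule.span 𝕜 (Set.range y)) :=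
    FiniteDimensional.span_of_finite 𝕜 (Set.finite_range y)
  refine IsFiniteRank.of_mem (Submodule.span 𝕜 (Set.range y)) fun x => ?_
  rw [_root_.sum_apply]
  exact Submodule.sum_mem _ fun j _ =>
    Submodule.smul_mem _ _ (Submodule.subset_span (Set.mem_range_self j))

lemma IsFiniteRank.add {S T : X →L[𝕜] Y} (hS : IsFiniteRank S) (hT : IsFiniteRank T) :
    IsFiniteRank (S + T) := by
  have : FiniteDimensional 𝕜 (LinearMap.range (S : X →ₗ[𝕜] Y)) := hS
  have : FiniteDimensional 𝕜 (LinearMap.range (T : X →ₗ[𝕜] Y)) := hT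
  exact IsFiniteRank.of_mem
    (LinearMap.range (S : X →ₗ[𝕜] Y) ⊔ LinearMap.range (T : X →ₗ[𝕜] Y)) fun x =>
      Submodule.add_mem_sup ⟨x, rfl⟩ ⟨x, rfl⟩

lemma IsFiniteRank.clm_comp {S : X →L[𝕜] Y} (hS : IsFiniteRank S) (R : Y →L[𝕜] Z) :
    IsFiniteRank (R.comp S) := by
  have : FiniteDimensional 𝕜 (LinearMap.range (S : X →ₗ[𝕜] Y)) := hS
  exact IsFiniteRank.of_mem ((LinearMap.range (S : X →ₗ[𝕜] Y)).map (R : Y →ₗ[𝕜] Z)) fun x =>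
    ⟨S x, ⟨x, rfl⟩, rfl⟩

lemma IsFiniteRank.comp_clm {S : Y →L[𝕜] Z} (hS : IsFiniteRank S) (R : X →L[𝕜] Y) :
    IsFiniteRank (S.comp R) := by
  have : FiniteDimensional 𝕜 (LinearMap.range (S : Y →ₗ[𝕜] Z)) := hS
  exact IsFiniteRank.of_mem (LinearMap.range (S : Y →ₗ[𝕜] Z)) fun x => ⟨R x, rfl⟩

lemma IsFiniteRank.sub {S T : X →L[𝕜] Y} (hS : IsFiniteRank S) (hT : IsFiniteRank T) :
    IsFiniteRank (S - T) := by
  have h : IsFiniteRank ((-ContinuousLinearMap.id 𝕜 Y).comp T) := hT.clm_comp _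
  have : S - T = S + (-ContinuousLinearMap.id 𝕜 Y).comp T := by
    ext x; simp [sub_eq_add_neg]
  rw [this]
  exact hS.add h

/-- The `v j` are the coordinates of `S` in a basis of its range, and `x j` is a preimage of the
`j`-th basis vector. Since the vectors are values of `S` itself, the same `v` and `x` also represent
every `R ∘ S`. -/
lemma IsFiniteRank.exists_eq_sum {S : X →L[𝕜] Y} (hS : IsFiniteRank S) :
    ∃ (n : ℕ) (v : Fin n → Dual 𝕜 X) (x : Fin n → X), S = ∑ j, (v j).smulRight (S (x j)) := by
  have : FiniteDimensional 𝕜 (LinearMap.range (S : X →ₗ[𝕜] Y)) := hS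
  let b := Module.finBasis 𝕜 (LinearMap.range (S : X →ₗ[𝕜] Y))
  choose x hx using fun j => (b j).2
  let R : X →L[𝕜] LinearMap.range (S : X →ₗ[𝕜] Y) :=
    S.codRestrict _ fun x => ⟨x, rfl⟩
  refine ⟨_, fun j => (LinearMap.toContinuousLinearMap (b.coord j)).comp R, x, ?_⟩
  ext z
  have h := congrArg Subtype.val (b.sum_repr (R z))
  rw [AddSubmonoidClass.coe_finsetSum] at h
  rw [_root_.sum_apply]
  refine h.symm.trans (Finset.sum_congr rfl fun j _ => ?_)
  have hj : S (x j) = b j := hx j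
  simp [hj]

lemma IsFiniteRank.isCompactOperator {S : X →L[𝕜] Y} (hS : IsFiniteRank S) :
    IsCompactOperator S := by
  have : FiniteDimensional 𝕜 (LinearMap.range (S : X →ₗ[𝕜] Y)) := hS
  have : ProperSpace (LinearMap.range (S : X →ₗ[𝕜] Y)) := FiniteDimensional.proper 𝕜 _
  let R : X →L[𝕜] LinearMap.range (S : X →ₗ[𝕜] Y) := S.codRestrict _ fun x => ⟨x, rfl⟩
  have h : IsCompactOperator R :=
    isCompactOperator_of_locallyCompactSpace_dom R
  exact h.clm_comp (LinearMap.range (S : X →ₗ[𝕜] Y)).subtypeL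

end FiniteRank

/-! ### Factorization through `ℓ^p_N` and the norm `K_p^0` -/

section FiniteFactorization

variable {𝕜 : Type*} [RCLike 𝕜] {p : ℝ≥0∞} [hp1 : Fact (1 ≤ p)]
variable {X : Type*} [NormedAddCommGroup X] [NormedSpace 𝕜 X]
variable {Y : Type*} [NormedAddCommGroup Y] [NormedSpace 𝕜 Y]
variable {Z : Type*} [NormedAddCommGroup Z] [NormedSpace 𝕜 Z]

lemma norm_inclFin_comp_le {N : ℕ} (A : X →L[𝕜] PiLp p (fun _ : Fin N => 𝕜)) :
    ‖(inclFin 𝕜 p N).comp A‖ ≤ ‖A‖ := by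
  have h := norm_inclFin_le (𝕜 := 𝕜) (p := p) N
  apply opNorm_comp_le_right
  exact h

lemma norm_projFin_comp_le {N : ℕ} (A : X →L[𝕜] lp (fun _ : ℕ => 𝕜) p) :
    ‖(projFin 𝕜 p N).comp A‖ ≤ ‖A‖ := by
  have h := norm_projFin_le (𝕜 := 𝕜) (p := p) N
  apply opNorm_comp_le_right
  exact h

lemma norm_comp_projFin_le {N : ℕ} (B : PiLp p (fun _ : Fin N => 𝕜) →L[𝕜] Y) :
    ‖B.comp (projFin 𝕜 p N)‖ ≤ ‖B‖ := by
  have h := norm_projFin_le (𝕜 := 𝕜) (p := p) N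
  apply opNorm_comp_le_left
  exact h

lemma norm_comp_inclFin_le {N : ℕ} (B : lp (fun _ : ℕ => 𝕜) p →L[𝕜] Y) :
    ‖B.comp (inclFin 𝕜 p N)‖ ≤ ‖B‖ := by
  have h := norm_inclFin_le (𝕜 := 𝕜) (p := p) N
  apply opNorm_comp_le_left
  exact h

/-- An operator into `ℓ^p` all of whose values are supported in `{0, …, N - 1}`. -/
def SupportedBelow (A : X →L[𝕜] lp (fun _ : ℕ => 𝕜) p) (N : ℕ) : Prop :=
  ∀ x k, N ≤ k → A x k = 0

lemma SupportedBelow.trunc_comp {A : X →L[𝕜] lp (fun _ : ℕ => 𝕜) p} {M N : ℕ}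
    (h : SupportedBelow A M) (hMN : M ≤ N) : (trunc 𝕜 p N).comp A = A := by
  ext1 x
  exact trunc_eq_self fun k hk => h x k (hMN.trans hk)

lemma supportedBelow_trunc_comp (A : X →L[𝕜] lp (fun _ : ℕ => 𝕜) p) (N : ℕ) :
    SupportedBelow ((trunc 𝕜 p N).comp A) N := fun x k hk => by
  rw [ContinuousLinearMap.comp_apply, trunc_apply, if_neg (not_lt.2 hk)]

lemma SupportedBelow.mono {A : X →L[𝕜] lp (fun _ : ℕ => 𝕜) p} {M N : ℕ}
    (h : SupportedBelow A M) (hMN : M ≤ N) : SupportedBelow A N :=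
  fun x k hk => h x k (hMN.trans hk)

lemma SupportedBelow.sub {A A' : X →L[𝕜] lp (fun _ : ℕ => 𝕜) p} {N : ℕ}
    (h : SupportedBelow A N) (h' : SupportedBelow A' N) : SupportedBelow (A - A') N :=
  fun x k hk => by
    rw [_root_.sub_apply, lp.coeFn_sub, Pi.sub_apply, h x k hk, h' x k hk, sub_zero]

lemma SupportedBelow.add {A A' : X →L[𝕜] lp (fun _ : ℕ => 𝕜) p} {N : ℕ}
    (h : SupportedBelow A N) (h' : SupportedBelow A' N) : SupportedBelow (A + A') N :=
  fun x k hk => by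
    rw [_root_.add_apply, lp.coeFn_add, Pi.add_apply, h x k hk, h' x k hk, add_zero]

lemma SupportedBelow.blockIncl_comp {A : X →L[𝕜] lp (fun _ : ℕ => 𝕜) p} {N : ℕ}
    (h : SupportedBelow A N) (m : ℕ) : ∃ M, SupportedBelow ((blockIncl m).comp A) M := by
  -- Any bound exceeding all `Nat.pair m j` with `j < N` will do; this sum is one.
  refine ⟨∑ j ∈ Finset.range N, (Nat.pair m j + 1), fun x k hk => ?_⟩
  rw [ContinuousLinearMap.comp_apply, blockIncl_apply]
  split_ifs with hm
  · refine h _ _ (not_lt.1 fun hlt => ?_)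
    have h1 : Nat.pair m k.unpair.2 + 1 ≤ ∑ j ∈ Finset.range N, (Nat.pair m j + 1) :=
      Finset.single_le_sum (f := fun j => Nat.pair m j + 1) (fun _ _ => Nat.zero_le _)
        (Finset.mem_range.2 hlt)
    rw [← hm, Nat.pair_unpair] at h1
    rw [← hm] at hk
    omega
  · rfl

lemma isFiniteRank_trunc (N : ℕ) : IsFiniteRank (trunc 𝕜 p N) := by
  rw [← inclFin_comp_projFin]
  exact IsFiniteRank.comp_clm (S := inclFin 𝕜 p N)
    (inferInstanceAs (FiniteDimensional 𝕜 (LinearMap.range _))) _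

lemma SupportedBelow.isFiniteRank {A : X →L[𝕜] lp (fun _ : ℕ => 𝕜) p} {N : ℕ}
    (h : SupportedBelow A N) : IsFiniteRank A := by
  rw [← h.trunc_comp le_rfl]
  exact (isFiniteRank_trunc N).comp_clm A

variable (p) in
/-- `S` factors through some `ℓ^p_N` into two operators of norm at most `c`. -/
def FinFactors (S : X →L[𝕜] Y) (c : ℝ) : Prop :=
  ∃ (N : ℕ) (A : X →L[𝕜] lp (fun _ : ℕ => 𝕜) p) (B : lp (fun _ : ℕ => 𝕜) p →L[𝕜] Y),
    SupportedBelow A N ∧ S = B.comp A ∧ ‖A‖ ≤ c ∧ ‖B‖ ≤ c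

lemma FinFactors.mono {S : X →L[𝕜] Y} {c d : ℝ} (h : FinFactors p S c) (hcd : c ≤ d) :
    FinFactors p S d := by
  obtain ⟨N, A, B, hA, hS, h1, h2⟩ := h
  exact ⟨N, A, B, hA, hS, h1.trans hcd, h2.trans hcd⟩

lemma FinFactors.norm_le {S : X →L[𝕜] Y} {c : ℝ} (h : FinFactors p S c) : ‖S‖ ≤ c * c := by
  obtain ⟨N, A, B, hA, rfl, h1, h2⟩ := h
  exact opNorm_comp_le_of_le h2 h1

lemma FinFactors.neg {S : X →L[𝕜] Y} {c : ℝ} (h : FinFactors p S c) : FinFactors p (-S) c := by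
  obtain ⟨N, A, B, hA, rfl, h1, h2⟩ := h
  exact ⟨N, A, -B, hA, by ext; simp, h1, by rwa [norm_neg]⟩

/-- Only the product of the norms matters: dividing `A` by `‖A‖ / c` and multiplying `B` by it
balances the two factors. This needs `A ≠ 0`. -/
lemma finFactors_of_mul_le {A : X →L[𝕜] lp (fun _ : ℕ => 𝕜) p}
    {B : lp (fun _ : ℕ => 𝕜) p →L[𝕜] Y} {N : ℕ} (hA : SupportedBelow A N) {c : ℝ} (hc : 0 < c)
    (h : ‖A‖ * ‖B‖ ≤ c * c) : FinFactors p (B.comp A) c := by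
  rcases (norm_nonneg A).eq_or_lt with h0 | h0
  · have : A = 0 := norm_eq_zero.1 h0.symm
    subst this
    exact ⟨N, 0, 0, hA, by simp, by simpa using hc.le, by simpa using hc.le⟩
  · have hn : ((‖A‖ / c : ℝ) : 𝕜) ≠ 0 := by
      rw [Ne, RCLike.ofReal_eq_zero]
      positivity
    refine ⟨N, ((‖A‖ / c : ℝ) : 𝕜)⁻¹ • A, ((‖A‖ / c : ℝ) : 𝕜) • B, ?_, ?_, ?_, ?_⟩
    · intro x k hk
      rw [_root_.smul_apply, lp.coeFn_smul, Pi.smul_apply, hA x k hk, smul_zero]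
    · rw [ContinuousLinearMap.smul_comp, ContinuousLinearMap.comp_smul, smul_smul,
        mul_inv_cancel₀ hn, one_smul]
    · rw [norm_smul, norm_inv, RCLike.norm_ofReal, abs_of_nonneg (by positivity), inv_div,
        div_mul_cancel₀ _ h0.ne']
    · rw [norm_smul, RCLike.norm_ofReal, abs_of_nonneg (by positivity), div_mul_eq_mul_div,
        div_le_iff₀ hc]
      exact h

/-- The two factorizations are placed in different blocks, so the cross terms vanish. The triangle
inequality on each factor is crude, but enough for geometric series. -/
lemma FinFactors.add {S T : X →L[𝕜] Y} {c d : ℝ} (hS : FinFactors p S c)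
    (hT : FinFactors p T d) : FinFactors p (S + T) (c + d) := by
  obtain ⟨M, A, B, hA, rfl, hA1, hB1⟩ := hS
  obtain ⟨N, A', B', hA', rfl, hA'1, hB'1⟩ := hT
  obtain ⟨M₀, hM⟩ := hA.blockIncl_comp 0
  obtain ⟨M₁, hM'⟩ := hA'.blockIncl_comp 1
  refine ⟨max M₀ M₁, (blockIncl 0).comp A + (blockIncl 1).comp A',
    B.comp (blockProj 0) + B'.comp (blockProj 1), ?_, ?_, ?_, ?_⟩
  · exact (hM.mono (le_max_left _ _)).add (hM'.mono (le_max_right _ _))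
  · ext x
    simp [blockProj_blockIncl]
  · refine (norm_add_le _ _).trans (add_le_add ?_ ?_)
    · exact (opNorm_comp_le_right (norm_blockIncl_le 0) A).trans hA1
    · exact (opNorm_comp_le_right (norm_blockIncl_le 1) A').trans hA'1
  · refine (norm_add_le _ _).trans (add_le_add ?_ ?_)
    · exact (opNorm_comp_le_left B (norm_blockProj_le 0)).trans hB1
    · exact (opNorm_comp_le_left B' (norm_blockProj_le 1)).trans hB'1

lemma supportedBelow_inclFin_comp {N : ℕ} (A : X →L[𝕜] PiLp p (fun _ : Fin N => 𝕜)) :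
    SupportedBelow ((inclFin 𝕜 p N).comp A) N := fun x k hk => by
  rw [ContinuousLinearMap.comp_apply, inclFin_apply, dif_neg (not_lt.2 hk)]

lemma finFactors_of_piLp {N : ℕ} (A : X →L[𝕜] PiLp p (fun _ : Fin N => 𝕜))
    (B : PiLp p (fun _ : Fin N => 𝕜) →L[𝕜] Y) {c : ℝ} (hc : 0 < c) (h : ‖A‖ * ‖B‖ ≤ c * c) :
    FinFactors p (B.comp A) c := by
  have h1 : B.comp A = (B.comp (projFin 𝕜 p N)).comp ((inclFin 𝕜 p N).comp A) := by
    ext x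
    simp [projFin_inclFin]
  rw [h1]
  refine finFactors_of_mul_le (supportedBelow_inclFin_comp A) hc (le_trans ?_ h)
  gcongr
  · exact norm_inclFin_comp_le A
  · exact norm_comp_projFin_le B

omit hp1 in
lemma colOp_comp_rowOp {n : ℕ} (v : Fin n → Dual 𝕜 X) (y : Fin n → Y) :
    (colOp p y).comp (rowOp p v) = ∑ j, (v j).smulRight (y j) := by
  ext x
  simp [colOp_apply, rowOp_apply]

/-- A crude bound, used for error terms of fixed rank in which one of the two sums is small. -/
lemma finFactors_sum_smulRight {n : ℕ} (v : Fin n → Dual 𝕜 X) (y : Fin n → Y) {c : ℝ}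
    (hc : 0 < c) (h : (∑ j, ‖v j‖) * ∑ j, ‖y j‖ ≤ c * c) :
    FinFactors p (∑ j, (v j).smulRight (y j)) c := by
  rw [← colOp_comp_rowOp (p := p)]
  refine finFactors_of_piLp _ _ hc (le_trans ?_ h)
  gcongr
  · refine ContinuousLinearMap.opNorm_le_bound _ (by positivity) fun x => ?_
    rw [rowOp_apply, Finset.sum_mul]
    refine (norm_toLp_le_sum _).trans (Finset.sum_le_sum fun j _ => ?_)
    exact (v j).le_opNorm x
  · refine ContinuousLinearMap.opNorm_le_bound _ (by positivity) fun x => ?_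
    rw [colOp_apply, Finset.sum_mul]
    refine (norm_sum_le _ _).trans (Finset.sum_le_sum fun j _ => ?_)
    rw [norm_smul, mul_comm]
    gcongr
    exact PiLp.norm_apply_le x j

lemma IsFiniteRank.finFactors {S : X →L[𝕜] Y} (hS : IsFiniteRank S) :
    ∃ c, 0 < c ∧ FinFactors p S c := by
  obtain ⟨n, v, x, h⟩ := hS.exists_eq_sum
  have h0 : 0 ≤ (∑ j, ‖v j‖) * ∑ j, ‖S (x j)‖ := by positivity
  have h1 := finFactors_sum_smulRight (p := p) v (fun j => S (x j))
    (c := 1 + (∑ j, ‖v j‖) * ∑ j, ‖S (x j)‖) (by linarith) (by nlinarith)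
  rw [← h] at h1
  exact ⟨_, by linarith, h1⟩

lemma finNorm_set_nonneg (S : X →L[𝕜] Y) {c : ℝ}
    (h : ∃ (n : ℕ) (α : Fin n → 𝕜) (x' : Fin n → Dual 𝕜 X) (y : Fin n → Y),
      S = ∑ j, α j • (x' j).smulRight (y j) ∧
      c = (⨆ j, ‖α j‖) * weakNorm 𝕜 p x' * weakNorm 𝕜 p.conjExponent y) : 0 ≤ c := by
  obtain ⟨n, α, x', y, -, rfl⟩ := h
  have h1 := weakNorm_nonneg (𝕜 := 𝕜) p x'
  have h2 := weakNorm_nonneg (𝕜 := 𝕜) p.conjExponent y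
  have h3 : 0 ≤ ⨆ j, ‖α j‖ := Real.iSup_nonneg fun _ => norm_nonneg _
  positivity

lemma finNorm_comp_le {A : X →L[𝕜] lp (fun _ : ℕ => 𝕜) p} {N : ℕ} (hA : SupportedBelow A N)
    (B : lp (fun _ : ℕ => 𝕜) p →L[𝕜] Y) : finNorm p (B.comp A) ≤ ‖A‖ * ‖B‖ := by
  let x' : Fin N → Dual 𝕜 X := fun j => (PiLp.proj p (fun _ : Fin N => 𝕜) j).comp
    ((projFin 𝕜 p N).comp A)
  let y : Fin N → Y := fun j => (B.comp (inclFin 𝕜 p N)) (WithLp.toLp p (Pi.single j 1))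
  have hrow : rowOp p x' = (projFin 𝕜 p N).comp A := rfl
  have hcol : colOp p y = B.comp (inclFin 𝕜 p N) := (eq_colOp _).symm
  have hS : B.comp A = ∑ j, (x' j).smulRight (y j) := by
    rw [← colOp_comp_rowOp (p := p), hrow, hcol, ContinuousLinearMap.comp_assoc,
      ← ContinuousLinearMap.comp_assoc _ _ A, inclFin_comp_projFin, hA.trunc_comp le_rfl]
  have hmem : finNorm p (B.comp A) ≤
      (⨆ _ : Fin N, ‖(1 : 𝕜)‖) * weakNorm 𝕜 p x' * weakNorm 𝕜 p.conjExponent y :=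
    csInf_le ⟨0, fun c hc => finNorm_set_nonneg _ hc⟩
      ⟨N, fun _ => 1, x', y, by simpa using hS, rfl⟩
  refine hmem.trans ?_
  -- Only an inequality: for `N = 0` the supremum is the default value 0.
  have h1 : (⨆ _ : Fin N, ‖(1 : 𝕜)‖) ≤ 1 :=
    Real.iSup_le (fun _ => by simp) zero_le_one
  have h2 : weakNorm 𝕜 p x' ≤ ‖A‖ := (weakNorm_le_norm_rowOp x').trans (by
    rw [hrow]
    exact norm_projFin_comp_le A)
  have h3 : weakNorm 𝕜 p.conjExponent y ≤ ‖B‖ := (weakNorm_le_norm_colOp (p := p) y).trans (by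
    rw [hcol]
    exact norm_comp_inclFin_le B)
  have h4 := weakNorm_nonneg (𝕜 := 𝕜) p x'
  have h5 := weakNorm_nonneg (𝕜 := 𝕜) p.conjExponent y
  calc _ ≤ 1 * ‖A‖ * ‖B‖ := by gcongr
    _ = _ := by ring

/-- Finite rank makes the set of representations nonempty; the infimum of the empty set would be 0
by default. The scalars `α j` are absorbed into the row operator as a diagonal multiplier of norm at
most `sup |α_j|`. -/
lemma IsFiniteRank.finFactors_of_finNorm_lt {S : X →L[𝕜] Y} (hS : IsFiniteRank S) {c : ℝ}
    (hc : 0 < c) (h : finNorm p S < c * c) : FinFactors p S c := by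
  obtain ⟨n, v, x, hv⟩ := hS.exists_eq_sum
  unfold finNorm at h
  obtain ⟨_, ⟨n, α, x', y, hS', rfl⟩, hlt⟩ := exists_lt_of_csInf_lt
    (s := {c : ℝ | ∃ (n : ℕ) (α : Fin n → 𝕜) (x' : Fin n → Dual 𝕜 X) (y : Fin n → Y),
      S = ∑ j, α j • (x' j).smulRight (y j) ∧
      c = (⨆ j, ‖α j‖) * weakNorm 𝕜 p x' * weakNorm 𝕜 p.conjExponent y})
    ⟨_, n, fun _ => 1, v, fun j => S (x j), by simpa using hv, rfl⟩ h
  have h1 : S = (colOp p y).comp (rowOp p fun j => α j • x' j) := by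
    rw [colOp_comp_rowOp, hS']
    refine Finset.sum_congr rfl fun j _ => ?_
    ext x
    simp [smul_smul]
  rw [h1]
  refine finFactors_of_piLp _ _ hc (le_trans ?_ hlt.le)
  have h3 : 0 ≤ ⨆ j, ‖α j‖ := Real.iSup_nonneg fun _ => norm_nonneg _
  gcongr
  · exact mul_nonneg h3 (weakNorm_nonneg p x')
  · refine ContinuousLinearMap.opNorm_le_bound _ (mul_nonneg h3 (weakNorm_nonneg p x'))
      fun x => ?_
    refine (norm_mul_le hp1.out α fun j => x' j x).trans ?_
    rw [mul_assoc]
    gcongr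
    exact (rowOp p x').le_of_opNorm_le (norm_rowOp_le x') x
  · exact norm_colOp_le y

end FiniteFactorization

/-! ### Factorizations that are limits of their truncations, and `K_p` -/

section ApproximableFactorization

variable {𝕜 : Type*} [RCLike 𝕜] {p : ℝ≥0∞} [hp1 : Fact (1 ≤ p)]
variable {X : Type*} [NormedAddCommGroup X] [NormedSpace 𝕜 X]
variable {Y : Type*} [NormedAddCommGroup Y] [NormedSpace 𝕜 Y]
variable {Z : Type*} [NormedAddCommGroup Z] [NormedSpace 𝕜 Z]

lemma tendsto_clm_comp {ι : Type*} {l : Filter ι} {f : ι → Y →L[𝕜] Z} {g : ι → X →L[𝕜] Y}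
    {f₀ : Y →L[𝕜] Z} {g₀ : X →L[𝕜] Y} (hf : Tendsto f l (𝓝 f₀)) (hg : Tendsto g l (𝓝 g₀)) :
    Tendsto (fun i => (f i).comp (g i)) l (𝓝 (f₀.comp g₀)) :=
  ((isBoundedBilinearMap_comp (𝕜 := 𝕜) (E := X) (F := Y) (G := Z)).continuous.tendsto
    (f₀, g₀)).comp (hf.prodMk_nhds hg)

variable (p) in
/-- `T = B A` through `ℓ^p`, where `A` and `B` are the norm limits of their truncations. -/
def ApproxFactors (T : X →L[𝕜] Y) : Prop :=
  ∃ (A : X →L[𝕜] lp (fun _ : ℕ => 𝕜) p) (B : lp (fun _ : ℕ => 𝕜) p →L[𝕜] Y),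
    T = B.comp A ∧ Tendsto (fun N => (trunc 𝕜 p N).comp A) atTop (𝓝 A) ∧
      Tendsto (fun N => B.comp (trunc 𝕜 p N)) atTop (𝓝 B)

/-- Truncations are contractions, so their convergence passes from the `A n`, which large
truncations fix, to the norm limit. -/
lemma tendsto_trunc_comp {A : ℕ → X →L[𝕜] lp (fun _ : ℕ => 𝕜) p}
    {A₀ : X →L[𝕜] lp (fun _ : ℕ => 𝕜) p} (hA : Tendsto A atTop (𝓝 A₀))
    (h : ∀ n, ∃ M, SupportedBelow (A n) M) :
    Tendsto (fun N => (trunc 𝕜 p N).comp A₀) atTop (𝓝 A₀) := by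
  rw [Metric.tendsto_atTop]
  intro ε hε
  obtain ⟨n, hn⟩ := ((Metric.tendsto_nhds.1 hA) (ε / 2) (half_pos hε)).exists
  obtain ⟨M, hM⟩ := h n
  refine ⟨M, fun N hN => ?_⟩
  rw [dist_eq_norm] at hn ⊢
  have h1 : (trunc 𝕜 p N).comp A₀ - A₀ = (A n - A₀) - (trunc 𝕜 p N).comp (A n - A₀) := by
    rw [ContinuousLinearMap.comp_sub, hM.trunc_comp hN]
    abel
  rw [h1]
  refine (norm_sub_le _ _).trans_lt ?_
  have h2 := opNorm_comp_le_right (norm_trunc_le (𝕜 := 𝕜) (p := p) N) (A n - A₀)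
  linarith

lemma tendsto_comp_trunc {B : ℕ → lp (fun _ : ℕ => 𝕜) p →L[𝕜] Y}
    {B₀ : lp (fun _ : ℕ => 𝕜) p →L[𝕜] Y} (hB : Tendsto B atTop (𝓝 B₀))
    (h : ∀ n, ∃ M, ∀ N, M ≤ N → (B n).comp (trunc 𝕜 p N) = B n) :
    Tendsto (fun N => B₀.comp (trunc 𝕜 p N)) atTop (𝓝 B₀) := by
  rw [Metric.tendsto_atTop]
  intro ε hε
  obtain ⟨n, hn⟩ := ((Metric.tendsto_nhds.1 hB) (ε / 2) (half_pos hε)).exists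
  obtain ⟨M, hM⟩ := h n
  refine ⟨M, fun N hN => ?_⟩
  rw [dist_eq_norm] at hn ⊢
  have h1 : B₀.comp (trunc 𝕜 p N) - B₀ = (B n - B₀) - (B n - B₀).comp (trunc 𝕜 p N) := by
    rw [ContinuousLinearMap.sub_comp, hM N hN]
    abel
  rw [h1]
  refine (norm_sub_le _ _).trans_lt ?_
  have h2 := opNorm_comp_le_left (B n - B₀) (norm_trunc_le (𝕜 := 𝕜) (p := p) N)
  linarith

lemma exists_supportedBelow_sum {ι : Type*} (s : Finset ι)
    (A : ι → X →L[𝕜] lp (fun _ : ℕ => 𝕜) p)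
    (h : ∀ i, ∃ M, SupportedBelow (A i) M) : ∃ M, SupportedBelow (∑ i ∈ s, A i) M := by
  classical
  induction s using Finset.induction_on with
  | empty => exact ⟨0, fun x k _ => by simp⟩
  | insert a s ha ih =>
    obtain ⟨M, hM⟩ := ih
    obtain ⟨M', hM'⟩ := h a
    rw [Finset.sum_insert ha]
    exact ⟨max M' M, (hM'.mono (le_max_left _ _)).add (hM.mono (le_max_right _ _))⟩

lemma exists_sum_comp_trunc {ι : Type*} (s : Finset ι)
    (B : ι → lp (fun _ : ℕ => 𝕜) p →L[𝕜] Y)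
    (h : ∀ i, ∃ M, ∀ N, M ≤ N → (B i).comp (trunc 𝕜 p N) = B i) :
    ∃ M, ∀ N, M ≤ N → (∑ i ∈ s, B i).comp (trunc 𝕜 p N) = ∑ i ∈ s, B i := by
  classical
  induction s using Finset.induction_on with
  | empty => exact ⟨0, fun N _ => by simp⟩
  | insert a s ha ih =>
    obtain ⟨M, hM⟩ := ih
    obtain ⟨M', hM'⟩ := h a
    rw [Finset.sum_insert ha]
    refine ⟨max M' M, fun N hN => ?_⟩
    rw [ContinuousLinearMap.add_comp, hM' N (le_of_max_le_left hN), hM N (le_of_max_le_right hN)]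

lemma exists_trunc_blockProj (m n : ℕ) :
    ∃ M, ∀ N, M ≤ N → ((trunc 𝕜 p n).comp (blockProj m)).comp (trunc 𝕜 p N) =
      (trunc 𝕜 p n).comp (blockProj m) := by
  refine ⟨∑ j ∈ Finset.range n, (Nat.pair m j + 1), fun N hN => ?_⟩
  ext x k
  simp only [ContinuousLinearMap.comp_apply, trunc_apply, blockProj_apply]
  split_ifs with h1 h2
  · rfl
  · have h3 : Nat.pair m k + 1 ≤ ∑ j ∈ Finset.range n, (Nat.pair m j + 1) :=
      Finset.single_le_sum (f := fun j => Nat.pair m j + 1) (fun _ _ => Nat.zero_le _)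
        (Finset.mem_range.2 h1)
    omega
  · rfl

/-- The `k`-th factorization goes into the `k`-th block, and both series converge absolutely. The
truncation in `B'` does not affect the product, because `A k` is supported below `N k`; it makes
each `B' k` depend on finitely many coordinates, so that `∑ B' k` is a limit of its truncations even
for `p = ∞`. -/
lemma approxFactors_of_tendsto_sum [CompleteSpace Y] {S : ℕ → X →L[𝕜] Y} {T : X →L[𝕜] Y}
    {c : ℕ → ℝ} (hc : Summable c) (hS : ∀ k, FinFactors p (S k) (c k))
    (hT : Tendsto (fun n => ∑ k ∈ Finset.range n, S k) atTop (𝓝 T)) : ApproxFactors p T := by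
  choose N A B hA hAB hAc hBc using hS
  let A' : ℕ → X →L[𝕜] lp (fun _ : ℕ => 𝕜) p := fun k => (blockIncl k).comp (A k)
  let B' : ℕ → lp (fun _ : ℕ => 𝕜) p →L[𝕜] Y :=
    fun k => (B k).comp ((trunc 𝕜 p (N k)).comp (blockProj k))
  have hA' : Summable A' := Summable.of_norm_bounded hc fun k =>
    (opNorm_comp_le_right (norm_blockIncl_le k) (A k)).trans (hAc k)
  have hB' : Summable B' := Summable.of_norm_bounded hc fun k =>
    (opNorm_comp_le_left (B k) ((opNorm_comp_le_right (norm_trunc_le _) _).trans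
      (norm_blockProj_le k))).trans (hBc k)
  have hAt := hA'.hasSum.tendsto_sum_nat
  have hBt := hB'.hasSum.tendsto_sum_nat
  refine ⟨∑' k, A' k, ∑' k, B' k, ?_, ?_, ?_⟩
  · refine tendsto_nhds_unique hT ((tendsto_clm_comp hBt hAt).congr fun n => ?_)
    ext x
    rw [ContinuousLinearMap.comp_apply, _root_.sum_apply, _root_.sum_apply, _root_.sum_apply]
    refine Finset.sum_congr rfl fun k hk => ?_
    have h1 : blockProj k (∑ j ∈ Finset.range n, A' j x) = A k x := by
      rw [map_sum, Finset.sum_eq_single k]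
      · simp [A', blockProj_blockIncl]
      · intro j _ hj
        simp [A', blockProj_blockIncl, hj.symm]
      · exact fun h => absurd hk h
    change B k (trunc 𝕜 p (N k) (blockProj k (∑ j ∈ Finset.range n, A' j x))) = S k x
    rw [h1, hAB k, trunc_eq_self (hA k x)]
    rfl
  · exact tendsto_trunc_comp hAt fun n =>
      exists_supportedBelow_sum _ _ fun k => (hA k).blockIncl_comp k
  · refine tendsto_comp_trunc hBt fun n => exists_sum_comp_trunc _ _ fun k => ?_
    obtain ⟨M, hM⟩ := exists_trunc_blockProj (𝕜 := 𝕜) (p := p) k (N k)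
    exact ⟨M, fun n hn => by rw [ContinuousLinearMap.comp_assoc, hM n hn]⟩

lemma approxFactors_of_tendsto [CompleteSpace Y] {S : ℕ → X →L[𝕜] Y} {T : X →L[𝕜] Y} {C : ℝ}
    (h0 : FinFactors p (S 0) C)
    (h : ∀ k, FinFactors p (S (k + 1) - S k) (C * (1 / 2) ^ k))
    (hT : Tendsto S atTop (𝓝 T)) : ApproxFactors p T := by
  let R : ℕ → X →L[𝕜] Y := fun k => Nat.casesOn k (S 0) fun k => S (k + 1) - S k
  let c : ℕ → ℝ := fun k => Nat.casesOn k C fun k => C * (1 / 2) ^ k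
  have hR : ∀ n, ∑ k ∈ Finset.range (n + 1), R k = S n := fun n => by
    rw [Finset.sum_range_succ']
    change ∑ k ∈ Finset.range n, (S (k + 1) - S k) + S 0 = S n
    rw [Finset.sum_range_sub]
    abel
  refine approxFactors_of_tendsto_sum (c := c) (S := R) ?_ ?_ ?_
  · rw [← summable_nat_add_iff 1]
    exact summable_geometric_two.mul_left C
  · rintro (_ | k)
    · exact h0
    · exact h k
  · rw [← tendsto_add_atTop_iff_nat 1]
    simpa only [hR] using hT

lemma ApproxFactors.factorsCompactly [CompleteSpace Y] {T : X →L[𝕜] Y} (h : ApproxFactors p T) :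
    FactorsCompactly p T := by
  obtain ⟨A, B, hT, hA, hB⟩ := h
  exact ⟨A, B,
    isCompactOperator_of_tendsto hA (Eventually.of_forall fun N =>
      ((isFiniteRank_trunc N).comp_clm A).isCompactOperator),
    isCompactOperator_of_tendsto hB (Eventually.of_forall fun N =>
      ((isFiniteRank_trunc N).clm_comp B).isCompactOperator), hT⟩

lemma tendsto_comp_trunc_comp (B : lp (fun _ : ℕ => 𝕜) p →L[𝕜] Y)
    {A : X →L[𝕜] lp (fun _ : ℕ => 𝕜) p}
    (hA : Tendsto (fun N => (trunc 𝕜 p N).comp A) atTop (𝓝 A)) :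
    Tendsto (fun N => B.comp ((trunc 𝕜 p N).comp A)) atTop (𝓝 (B.comp A)) :=
  tendsto_clm_comp tendsto_const_nhds hA

/-- The operators `B trunc_N A` are Cauchy for `finNorm`, since `finNorm_comp_le` bounds their
differences by `‖B‖ ‖(trunc_m - trunc_n) A‖`. -/
lemma ApproxFactors.mem_Kp {T : X →L[𝕜] Y} (h : ApproxFactors p T) : T ∈ Kp 𝕜 p X Y := by
  obtain ⟨A, B, rfl, hA, -⟩ := h
  refine ⟨fun N => B.comp ((trunc 𝕜 p N).comp A), fun N =>
    ((isFiniteRank_trunc N).comp_clm A).clm_comp B, fun ε hε => ?_, tendsto_comp_trunc_comp B hA⟩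
  have hB : 0 < ‖B‖ + 1 := by positivity
  obtain ⟨N, hN⟩ := Metric.cauchySeq_iff.1 hA.cauchySeq (ε / (‖B‖ + 1)) (by positivity)
  refine ⟨N, fun m hm n hn => ?_⟩
  rw [← ContinuousLinearMap.comp_sub]
  have h1 := hN m hm n hn
  rw [dist_eq_norm] at h1
  have hsupp : SupportedBelow ((trunc 𝕜 p m).comp A - (trunc 𝕜 p n).comp A) (max m n) :=
    ((supportedBelow_trunc_comp A m).mono (le_max_left _ _)).sub
      ((supportedBelow_trunc_comp A n).mono (le_max_right _ _))
  refine (finNorm_comp_le hsupp B).trans_lt ?_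
  rw [lt_div_iff₀ hB] at h1
  refine lt_of_le_of_lt ?_ h1
  gcongr
  linarith

lemma approxFactors_of_mem_Kp [CompleteSpace Y] {T : X →L[𝕜] Y} (h : T ∈ Kp 𝕜 p X Y) :
    ApproxFactors p T := by
  obtain ⟨S, hS, hC, hT⟩ := h
  have h1 : ∀ k : ℕ, ∃ N, ∀ m ≥ N, ∀ n ≥ N,
      finNorm p (S m - S n) < (1 / 2) ^ k * (1 / 2) ^ k := fun k => hC _ (by positivity)
  choose N hN using h1
  -- The summand `k` forces `φ` to infinity; the sum makes it monotone and at least `N k`, so `φ k`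
  -- and `φ (k + 1)` both lie past `N k`.
  let φ : ℕ → ℕ := fun k => k + ∑ j ∈ Finset.range (k + 1), N j
  have hφN : ∀ k, N k ≤ φ k := fun k => by
    have := Finset.single_le_sum (f := N) (fun _ _ => Nat.zero_le _)
      (Finset.self_mem_range_succ k)
    exact this.trans (Nat.le_add_left _ _)
  have hφ : ∀ k, φ k ≤ φ (k + 1) := fun k => by
    simp only [φ, Finset.sum_range_succ _ (k + 1)]
    omega
  have hφt : Tendsto φ atTop atTop :=
    tendsto_atTop_mono (fun k => Nat.le_add_right _ _) tendsto_id
  obtain ⟨C, hC0, hC1⟩ := (hS (φ 0)).finFactors (p := p)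
  refine approxFactors_of_tendsto (S := fun k => S (φ k)) (C := C + 1) (hC1.mono (by linarith))
    (fun k => ?_) (hT.comp hφt)
  refine (((hS _).sub (hS _)).finFactors_of_finNorm_lt (p := p) (c := (1 / 2) ^ k) (by positivity)
    (hN k _ ((hφN k).trans (hφ k)) _ (hφN k))).mono ?_
  have : (0 : ℝ) < (1 / 2) ^ k := by positivity
  nlinarith

lemma ApproxFactors.clm_comp {T : X →L[𝕜] Y} (h : ApproxFactors p T) (R : Y →L[𝕜] Z) :
    ApproxFactors p (R.comp T) := by
  obtain ⟨A, B, rfl, hA, hB⟩ := h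
  exact ⟨A, R.comp B, rfl, hA, tendsto_clm_comp tendsto_const_nhds hB⟩

end ApproximableFactorization

/-! ### Compact factorizations are limits of truncations -/

section CompactFactorization

variable {𝕜 : Type*} [RCLike 𝕜] {p : ℝ≥0∞} [hp1 : Fact (1 ≤ p)]
variable {X : Type*} [NormedAddCommGroup X] [NormedSpace 𝕜 X]
variable {Y : Type*} [NormedAddCommGroup Y] [NormedSpace 𝕜 Y]

lemma exists_isCompact_of_isCompactOperator {A : X →L[𝕜] Y} (hA : IsCompactOperator A) :
    ∃ K : Set Y, IsCompact K ∧ ∀ x, ‖x‖ ≤ 1 → A x ∈ K := by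
  obtain ⟨K, hK, hAK⟩ := IsCompactOperator.image_closedBall_subset_compact
    (f := (A : X →ₗ[𝕜] Y)) hA 1
  exact ⟨K, hK, fun x hx => hAK ⟨x, by simpa using hx, rfl⟩⟩

lemma tendsto_trunc (hp : p ≠ ∞) (x : lp (fun _ : ℕ => 𝕜) p) :
    Tendsto (fun N => trunc 𝕜 p N x) atTop (𝓝 x) := by
  refine (lp.hasSum_single hp x).tendsto_sum_nat.congr fun N => ?_
  rw [trunc_eq_sum]
  refine Finset.sum_congr rfl fun j _ => ?_
  rw [← lp.single_smul, smul_eq_mul, mul_one]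

/-- For `p < ∞` truncations converge pointwise and `J` is the identity. For `p = ∞` they do not; but
the vectors `(z_n)_{z ∈ t}`, for `n` in `ℕ`, form a bounded set in a finite dimensional space, so
finitely many coordinates represent all of them up to `δ`, and `J` copies the representative `rep k`
into place `k`. -/
lemma exists_trunc_approx_finite (t : Set (lp (fun _ : ℕ => 𝕜) p)) (ht : t.Finite) {δ : ℝ}
    (hδ : 0 < δ) : ∃ (N : ℕ) (J : lp (fun _ : ℕ => 𝕜) p →L[𝕜] lp (fun _ : ℕ => 𝕜) p),
      ‖J‖ ≤ 1 ∧ ∀ z ∈ t, ‖J (trunc 𝕜 p N z) - z‖ ≤ δ := by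
  rcases eq_or_ne p ∞ with rfl | hp
  · have := ht.fintype
    let V : ℕ → t → 𝕜 := fun n z => (z : lp (fun _ : ℕ => 𝕜) ∞) n
    have hb : Bornology.IsBounded (Set.range V) := by
      refine isBounded_iff_forall_norm_le.2 ⟨∑ z : t, ‖(z : lp (fun _ : ℕ => 𝕜) ∞)‖, ?_⟩
      rintro _ ⟨n, rfl⟩
      refine (pi_norm_le_iff_of_nonneg (by positivity)).2 fun z => ?_
      exact (lp.norm_apply_le_norm ENNReal.top_ne_zero _ n).trans
        (Finset.single_le_sum (f := fun z : t => ‖(z : lp (fun _ : ℕ => 𝕜) ∞)‖)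
          (fun _ _ => norm_nonneg _) (Finset.mem_univ z))
    obtain ⟨s, hs, hsf, hcov⟩ := Metric.finite_approx_of_totallyBounded
      (hb.isCompact_closure.totallyBounded.subset subset_closure) δ hδ
    have h1 : ∀ n, ∃ m, V m ∈ s ∧ dist (V n) (V m) < δ := fun n => by
      obtain ⟨y, hy, hny⟩ := Set.mem_iUnion₂.1 (hcov (Set.mem_range_self n))
      obtain ⟨m, rfl⟩ := hs hy
      exact ⟨m, hy, hny⟩
    choose inv hinv using fun y : s => hs y.2
    choose m hm hmd using h1
    -- `m` itself may take infinitely many values; choosing one index for each point of the finite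
    -- net leaves finitely many.
    let rep : ℕ → ℕ := fun n => inv ⟨V (m n), hm n⟩
    have hrep : ∀ n, V (rep n) = V (m n) := fun n => hinv ⟨V (m n), hm n⟩
    have hfin : (Set.range rep).Finite := by
      have := hsf.to_subtype
      refine (Set.finite_range inv).subset ?_
      rintro _ ⟨n, rfl⟩
      exact Set.mem_range_self _
    obtain ⟨N, hN⟩ := hfin.bddAbove
    refine ⟨N + 1, pull (fun k => some (rep k)) (Or.inl rfl), norm_pull_le _ _, fun z hz => ?_⟩
    refine lp.norm_le_of_forall_le hδ.le fun k => ?_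
    have h2 : pull (fun k => some (rep k)) (Or.inl rfl) (trunc 𝕜 ∞ (N + 1) z) k = z (rep k) := by
      change trunc 𝕜 ∞ (N + 1) z (rep k) = z (rep k)
      rw [trunc_apply, if_pos (Nat.lt_succ_of_le (hN (Set.mem_range_self k)))]
    rw [lp.coeFn_sub, Pi.sub_apply, h2]
    have h3 := (dist_le_pi_dist (V k) (V (m k)) ⟨z, hz⟩).trans (hmd k).le
    rw [← hrep k, dist_comm, dist_eq_norm] at h3
    exact h3
  · have h1 : ∀ᶠ N in atTop, ∀ z ∈ t, ‖trunc 𝕜 p N z - z‖ ≤ δ := by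
      refine (Filter.eventually_all_finite ht).2 fun z _ => ?_
      filter_upwards [Metric.tendsto_nhds.1 (tendsto_trunc hp z) δ hδ] with N hN
      rw [← dist_eq_norm]
      exact hN.le
    obtain ⟨N, hN⟩ := h1.exists
    exact ⟨N, ContinuousLinearMap.id 𝕜 _, ContinuousLinearMap.norm_id_le, hN⟩

lemma exists_trunc_approx {A : X →L[𝕜] lp (fun _ : ℕ => 𝕜) p} (hA : IsCompactOperator A)
    {δ : ℝ} (hδ : 0 < δ) : ∃ (N : ℕ) (J : lp (fun _ : ℕ => 𝕜) p →L[𝕜] lp (fun _ : ℕ => 𝕜) p),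
      ‖J‖ ≤ 1 ∧ ‖A - J.comp ((trunc 𝕜 p N).comp A)‖ ≤ δ := by
  obtain ⟨K, hK, hAK⟩ := exists_isCompact_of_isCompactOperator hA
  obtain ⟨t, -, htf, hcov⟩ := Metric.finite_approx_of_totallyBounded hK.totallyBounded
    (δ / 3) (by positivity)
  obtain ⟨N, J, hJ, hJt⟩ := exists_trunc_approx_finite t htf (δ := δ / 3) (by positivity)
  refine ⟨N, J, hJ, ContinuousLinearMap.opNorm_le_of_unit_norm hδ.le fun x hx => ?_⟩
  obtain ⟨z, hz, hxz⟩ := Set.mem_iUnion₂.1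
    (hcov (hAK x hx.le))
  have h1 : ‖A x - z‖ < δ / 3 := by
    rw [← dist_eq_norm]
    exact hxz
  have h2 : ‖(J.comp (trunc 𝕜 p N)) (z - A x)‖ ≤ δ / 3 := by
    refine (ContinuousLinearMap.le_of_opNorm_le _
      ((opNorm_comp_le_right hJ _).trans (norm_trunc_le N)) _).trans ?_
    rw [one_mul, norm_sub_rev]
    exact h1.le
  have h3 : (A - J.comp ((trunc 𝕜 p N).comp A)) x =
      (A x - z) + (J.comp (trunc 𝕜 p N)) (z - A x) - (J (trunc 𝕜 p N z) - z) := by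
    simp only [_root_.sub_apply, ContinuousLinearMap.comp_apply, map_sub]
    abel
  rw [h3]
  have h4 := norm_sub_le (A x - z + (J.comp (trunc 𝕜 p N)) (z - A x)) (J (trunc 𝕜 p N z) - z)
  have h5 := norm_add_le (A x - z) ((J.comp (trunc 𝕜 p N)) (z - A x))
  have h6 := hJt z hz
  linarith

/-- Subtracting `J trunc_N R` from the remainder `R`, starting at `R = A`, keeps it compact and
brings its norm below `4^-(k+1)`. The removed pieces, followed by `B`, form a telescoping series for
`B A`, and each factors through some `ℓ^p_N`. -/
lemma FactorsCompactly.approxFactors [CompleteSpace Y] {T : X →L[𝕜] Y}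
    (h : FactorsCompactly p T) : ApproxFactors p T := by
  obtain ⟨A, B, hA, -, rfl⟩ := h
  have hstep : ∀ (k : ℕ) (R : {R : X →L[𝕜] lp (fun _ : ℕ => 𝕜) p // IsCompactOperator R}),
      ∃ (R' : {R : X →L[𝕜] lp (fun _ : ℕ => 𝕜) p // IsCompactOperator R}) (N : ℕ)
        (J : lp (fun _ : ℕ => 𝕜) p →L[𝕜] lp (fun _ : ℕ => 𝕜) p),
        ‖J‖ ≤ 1 ∧ R'.1 = R.1 - J.comp ((trunc 𝕜 p N).comp R.1) ∧
          ‖R'.1‖ ≤ (1 / 4) ^ (k + 1) := fun k R => by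
    obtain ⟨N, J, hJ, hR⟩ := exists_trunc_approx R.2 (δ := (1 / 4) ^ (k + 1)) (by positivity)
    exact ⟨⟨_, R.2.sub ((R.2.clm_comp (trunc 𝕜 p N)).clm_comp J)⟩, N, J, hJ, rfl, hR⟩
  choose next N J hJ hnext hnorm using hstep
  let R : ℕ → {R : X →L[𝕜] lp (fun _ : ℕ => 𝕜) p // IsCompactOperator R} :=
    fun k => Nat.rec ⟨A, hA⟩ next k
  have hRs : ∀ k, R (k + 1) = next k (R k) := fun _ => rfl
  have hRn : ∀ k, ‖(R k).1‖ ≤ (‖A‖ + 1) * (1 / 4) ^ k := by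
    rintro (_ | k)
    · change ‖A‖ ≤ _
      rw [pow_zero]
      linarith
    · rw [hRs]
      refine (hnorm k _).trans ?_
      have : (0 : ℝ) < (1 / 4) ^ (k + 1) := by positivity
      nlinarith [norm_nonneg A]
  have hRt : Tendsto (fun k => (R k).1) atTop (𝓝 0) := by
    refine squeeze_zero_norm hRn ?_
    rw [← mul_zero (‖A‖ + 1)]
    exact (tendsto_pow_atTop_nhds_zero_of_lt_one (by norm_num) (by norm_num)).const_mul _
  -- The constant has to satisfy `(‖A‖ + 1) ‖B‖ ≤ C²`; the factor `4^-k` is split evenly between the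
  -- two operators.
  refine approxFactors_of_tendsto (S := fun k => B.comp (A - (R k).1))
    (C := ‖A‖ + ‖B‖ + 1) ?_ (fun k => ?_) ?_
  · have : B.comp (A - (R 0).1) = 0 := by
      change B.comp (A - A) = 0
      simp
    rw [this]
    exact ⟨0, 0, 0, fun x k _ => by simp, by simp, by rw [norm_zero]; positivity,
      by rw [norm_zero]; positivity⟩
  · have h1 : B.comp (A - (R (k + 1)).1) - B.comp (A - (R k).1) =
        (B.comp (J k (R k))).comp ((trunc 𝕜 p (N k (R k))).comp (R k).1) := by
      rw [hRs, hnext, ← ContinuousLinearMap.comp_sub, ContinuousLinearMap.comp_assoc]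
      congr 1
      abel
    rw [h1]
    refine finFactors_of_mul_le (supportedBelow_trunc_comp _ _) (by positivity) ?_
    have h2 := (opNorm_comp_le_right (norm_trunc_le (N k (R k))) (R k).1).trans (hRn k)
    have h3 := opNorm_comp_le_left B (hJ k (R k))
    calc _ ≤ ((‖A‖ + 1) * (1 / 4) ^ k) * ‖B‖ := by gcongr
      _ = (((‖A‖ + 1) * ‖B‖)) * ((1 / 2) ^ k * (1 / 2) ^ k) := by
        rw [← mul_pow]
        norm_num
        ring
      _ ≤ ((‖A‖ + ‖B‖ + 1) * (‖A‖ + ‖B‖ + 1)) * ((1 / 2) ^ k * (1 / 2) ^ k) := by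
        gcongr <;> linarith [norm_nonneg A, norm_nonneg B]
      _ = _ := by ring
  · have h1 : Tendsto (fun k => A - (R k).1) atTop (𝓝 A) := by
      simpa using tendsto_const_nhds.sub hRt
    exact tendsto_clm_comp tendsto_const_nhds h1

end CompactFactorization

/-! ### Consequences of the Hahn–Banach theorem -/

section HahnBanach

variable {𝕜 : Type*} [RCLike 𝕜]
variable {Z : Type*} [NormedAddCommGroup Z] [NormedSpace 𝕜 Z]
variable {W : Type*} [NormedAddCommGroup W] [NormedSpace 𝕜 W]
variable {H : Type*} [NormedAddCommGroup H] [NormedSpace 𝕜 H]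

/-- Pull back a norming functional for the class of `z` in `Z / V`. As `V` need not be closed, the
quotient carries only a seminorm, the distance to `V`. -/
lemma exists_dual_vanishing (V : Submodule 𝕜 Z) (z : Z) :
    ∃ ψ : Dual 𝕜 Z, ‖ψ‖ ≤ 1 ∧ (∀ w ∈ V, ψ w = 0) ∧ ψ z = (‖V.mkQ z‖ : 𝕜) := by
  obtain ⟨g, hg, h⟩ := exists_dual_vector'' 𝕜 (V.mkQ z)
  refine ⟨g.comp V.mkQL, ?_, fun w hw => ?_, h⟩
  · refine ContinuousLinearMap.opNorm_le_bound _ zero_le_one fun x => ?_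
    refine (g.le_of_opNorm_le hg _).trans ?_
    gcongr
    exact Submodule.Quotient.norm_mk_le V x
  · rw [ContinuousLinearMap.comp_apply, Submodule.mkQL_apply, Submodule.mkQ_apply,
      (Submodule.Quotient.mk_eq_zero V).2 hw, map_zero]

lemma exists_norm_sub_lt_of_mkQ (V : Submodule 𝕜 Z) (z : Z) {r : ℝ} (h : ‖V.mkQ z‖ < r) :
    ∃ w ∈ V, ‖w - z‖ < r := by
  obtain ⟨m, hm, hmr⟩ := Submodule.Quotient.norm_mk_lt (V.mkQ z) (sub_pos.2 h)
  refine ⟨z - m, ?_, ?_⟩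
  · rw [← Submodule.Quotient.eq]
    exact hm.symm
  · rw [sub_sub_cancel_left, norm_neg]
    linarith

lemma exists_dual_ne_zero_of_notMem {V : Submodule 𝕜 Z} (hV : IsClosed (V : Set Z)) {z : Z}
    (hz : z ∉ V) : ∃ ψ : Dual 𝕜 Z, (∀ w ∈ V, ψ w = 0) ∧ ψ z ≠ 0 := by
  obtain ⟨ψ, -, h1, h2⟩ := exists_dual_vanishing V z
  refine ⟨ψ, h1, fun h0 => hz ?_⟩
  rw [h0] at h2
  have h3 : ‖V.mkQ z‖ = 0 := by exact_mod_cast h2.symm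
  rw [← SetLike.mem_coe, ← hV.closure_eq, Metric.mem_closure_iff]
  intro ε hε
  obtain ⟨w, hw, hwz⟩ := exists_norm_sub_lt_of_mkQ V z (h3.trans_lt hε)
  exact ⟨w, hw, by rwa [dist_comm, dist_eq_norm]⟩

/-- Helly's theorem: if a functional `w''` on the dual of `W` solves `R w = h` up to `ρ` weakly,
then some `w` in `W` solves it up to any larger constant. -/
lemma helly (R : W →L[𝕜] H) (w'' : Dual 𝕜 W → 𝕜) (hw0 : w'' 0 = 0) (h : H) {ρ r : ℝ}
    (hw : ∀ φ : Dual 𝕜 H, ‖w'' (φ.comp R) - φ h‖ ≤ ρ * ‖φ‖) (hρ : 0 ≤ ρ) (hr : ρ < r) :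
    ∃ w, ‖R w - h‖ < r := by
  -- As `ψ ∘ R = 0` and `ψ h` is the distance from `h` to the range of `R`, the hypothesis at `ψ`
  -- bounds that distance by `ρ`.
  obtain ⟨ψ, hψ, h1, h2⟩ := exists_dual_vanishing (LinearMap.range (R : W →ₗ[𝕜] H)) h
  have h3 : ψ.comp R = 0 := by
    ext w
    exact h1 _ ⟨w, rfl⟩
  have h4 := hw ψ
  rw [h3, hw0, zero_sub, norm_neg, h2, RCLike.norm_ofReal, abs_of_nonneg (norm_nonneg _)] at h4
  obtain ⟨_, ⟨w, rfl⟩, hw⟩ := exists_norm_sub_lt_of_mkQ (LinearMap.range (R : W →ₗ[𝕜] H)) h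
    (r := r) (by nlinarith)
  exact ⟨w, hw⟩

/-- The dual of a sup-sum is an `ℓ^1`-sum: with nearly norming `z i` of the right phase, `ψ (∑ J_i
z_i)` almost equals the left side. It serves both finite products and `c_0`-type families. -/
lemma sum_norm_comp_le {ι : Type*} (s : Finset ι) (J : ι → Z →L[𝕜] W)
    (hJ : ∀ z : ι → Z, (∀ i, ‖z i‖ ≤ 1) → ‖∑ i ∈ s, J i (z i)‖ ≤ 1) (ψ : Dual 𝕜 W) :
    ∑ i ∈ s, ‖ψ.comp (J i)‖ ≤ ‖ψ‖ := by
  refine le_of_forall_pos_le_add fun ε hε => ?_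
  have h1 : ∀ i, ∃ z : Z, ‖z‖ ≤ 1 ∧ ∃ r : ℝ, ψ (J i z) = (r : 𝕜) ∧
      ‖ψ.comp (J i)‖ ≤ r + ε / (s.card + 1) := fun i => by
    rcases (norm_nonneg (ψ.comp (J i))).eq_or_lt with h0 | h0
    · exact ⟨0, by simp, 0, by simp, by rw [← h0]; positivity⟩
    · obtain ⟨z, hz, hlt⟩ := ContinuousLinearMap.exists_lt_apply_of_lt_opNorm (ψ.comp (J i))
        (r := ‖ψ.comp (J i)‖ - ε / (s.card + 1)) (sub_lt_self _ (by positivity))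
      obtain ⟨u, hu, hur⟩ := exists_norm_le_one_mul_eq_norm (ψ (J i z))
      refine ⟨u • z, ?_, ‖ψ (J i z)‖, ?_, ?_⟩
      · rw [norm_smul]
        exact mul_le_one₀ hu (norm_nonneg _) hz.le
      · rw [map_smul, map_smul, smul_eq_mul, hur]
      · exact (sub_lt_iff_lt_add.1 hlt).le
  choose z hz r hr hle using h1
  have h2 : ψ (∑ i ∈ s, J i (z i)) = ((∑ i ∈ s, r i : ℝ) : 𝕜) := by
    rw [map_sum, RCLike.ofReal_sum]
    exact Finset.sum_congr rfl fun i _ => hr i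
  have h3 : ∑ i ∈ s, r i ≤ ‖ψ‖ := by
    refine (le_abs_self _).trans ?_
    rw [← RCLike.norm_ofReal (K := 𝕜), ← h2]
    refine (ψ.le_opNorm _).trans (mul_le_of_le_one_right (norm_nonneg _) (hJ z hz))
  calc ∑ i ∈ s, ‖ψ.comp (J i)‖ ≤ ∑ i ∈ s, (r i + ε / (s.card + 1)) :=
        Finset.sum_le_sum fun i _ => hle i
    _ = ∑ i ∈ s, r i + s.card * (ε / (s.card + 1)) := by
        rw [Finset.sum_add_distrib, Finset.sum_const, nsmul_eq_mul]
    _ ≤ ‖ψ‖ + ε := by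
        gcongr
        rw [mul_div_assoc', div_le_iff₀ (by positivity)]
        nlinarith

end HahnBanach

/-! ### Extension to the bidual -/

section Bidual

variable {𝕜 : Type*} [RCLike 𝕜] {p : ℝ≥0∞} [hp1 : Fact (1 ≤ p)]
variable {X : Type*} [NormedAddCommGroup X] [NormedSpace 𝕜 X]
variable {Y : Type*} [NormedAddCommGroup Y] [NormedSpace 𝕜 Y]

lemma norm_incl (y : Y) : ‖incl 𝕜 Y y‖ = ‖y‖ :=
  (NormedSpace.inclusionInDoubleDualLi (E := Y) 𝕜).norm_map y

lemma incl_injective : Function.Injective (incl 𝕜 Y) :=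
  (NormedSpace.inclusionInDoubleDualLi (E := Y) 𝕜).injective

lemma incl_apply (y : Y) (f : Dual 𝕜 Y) : incl 𝕜 Y y f = f y := rfl

lemma isClosed_range_incl [CompleteSpace Y] :
    IsClosed ((LinearMap.range (incl 𝕜 Y : Y →ₗ[𝕜] Dual 𝕜 (Dual 𝕜 Y)) :
      Submodule 𝕜 (Dual 𝕜 (Dual 𝕜 Y))) : Set (Dual 𝕜 (Dual 𝕜 Y))) :=
  (NormedSpace.inclusionInDoubleDualLi (E := Y) 𝕜).isometry.isClosedEmbedding.isClosed_range

/-- The second adjoint of the `N`-th truncation of `A : X → ℓ^p`, as an operator into `ℓ^p`. -/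
def bidualTrunc (A : X →L[𝕜] lp (fun _ : ℕ => 𝕜) p) (N : ℕ) :
    Dual 𝕜 (Dual 𝕜 X) →L[𝕜] lp (fun _ : ℕ => 𝕜) p :=
  ∑ j ∈ Finset.range N, (incl 𝕜 (Dual 𝕜 X) ((lp.evalCLM 𝕜 (fun _ : ℕ => 𝕜) p j).comp A)).smulRight
    (lp.single p j (1 : 𝕜))

lemma dual_trunc_comp (A : X →L[𝕜] lp (fun _ : ℕ => 𝕜) p) (N : ℕ)
    (g : Dual 𝕜 (lp (fun _ : ℕ => 𝕜) p)) :
    g.comp ((trunc 𝕜 p N).comp A) = ∑ j ∈ Finset.range N,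
      g (lp.single p j (1 : 𝕜)) • (lp.evalCLM 𝕜 (fun _ : ℕ => 𝕜) p j).comp A := by
  ext x
  rw [ContinuousLinearMap.comp_apply, ContinuousLinearMap.comp_apply, trunc_eq_sum, map_sum,
    _root_.sum_apply]
  refine Finset.sum_congr rfl fun j _ => ?_
  rw [map_smul, smul_eq_mul, mul_comm]
  rfl

lemma dual_bidualTrunc (A : X →L[𝕜] lp (fun _ : ℕ => 𝕜) p) (N : ℕ)
    (g : Dual 𝕜 (lp (fun _ : ℕ => 𝕜) p)) (x'' : Dual 𝕜 (Dual 𝕜 X)) :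
    g (bidualTrunc A N x'') = x'' (g.comp ((trunc 𝕜 p N).comp A)) := by
  rw [dual_trunc_comp, bidualTrunc, _root_.sum_apply, map_sum, map_sum]
  refine Finset.sum_congr rfl fun j _ => ?_
  rw [map_smul, ContinuousLinearMap.smulRight_apply, map_smul, smul_eq_mul, smul_eq_mul, mul_comm]
  rfl

lemma isFiniteRank_bidualTrunc (A : X →L[𝕜] lp (fun _ : ℕ => 𝕜) p) (N : ℕ) :
    IsFiniteRank (bidualTrunc A N) := by
  rw [bidualTrunc, ← Fin.sum_univ_eq_sum_range (fun j =>
    (incl 𝕜 (Dual 𝕜 X) ((lp.evalCLM 𝕜 (fun _ : ℕ => 𝕜) p j).comp A)).smulRight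
      (lp.single p j (1 : 𝕜)))]
  exact isFiniteRank_sum_smulRight _ _

lemma exists_tendsto_of_norm_sub_le {V W : Type*} [NormedAddCommGroup V] [NormedAddCommGroup W]
    [CompleteSpace W] {a : ℕ → V} {a₀ : V} (ha : Tendsto a atTop (𝓝 a₀)) {b : ℕ → W}
    (h : ∀ m n, ‖b m - b n‖ ≤ ‖a m - a n‖) : ∃ b₀, Tendsto b atTop (𝓝 b₀) := by
  refine cauchySeq_tendsto_of_complete (Metric.cauchySeq_iff.2 fun ε hε => ?_)
  obtain ⟨N, hN⟩ := Metric.cauchySeq_iff.1 ha.cauchySeq ε hε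
  refine ⟨N, fun m hm n hn => ?_⟩
  rw [dist_eq_norm]
  refine (h m n).trans_lt ?_
  rw [← dist_eq_norm]
  exact hN m hm n hn

/-- In general `A**` maps into `(ℓ^p)**`. Each truncation of `A` has a second adjoint with values in
the span of finitely many unit vectors of `ℓ^p`; passing to second adjoints does not increase norms,
so these converge to an operator into `ℓ^p`. -/
lemma exists_bidual_extension {A : X →L[𝕜] lp (fun _ : ℕ => 𝕜) p}
    (hA : Tendsto (fun N => (trunc 𝕜 p N).comp A) atTop (𝓝 A)) :
    ∃ A' : Dual 𝕜 (Dual 𝕜 X) →L[𝕜] lp (fun _ : ℕ => 𝕜) p,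
      Tendsto (bidualTrunc A) atTop (𝓝 A') ∧
        ∀ (g : Dual 𝕜 (lp (fun _ : ℕ => 𝕜) p)) x'', g (A' x'') = x'' (g.comp A) := by
  have hbound : ∀ m n, ‖bidualTrunc A m - bidualTrunc A n‖ ≤
      ‖(trunc 𝕜 p m).comp A - (trunc 𝕜 p n).comp A‖ := fun m n => by
    refine ContinuousLinearMap.opNorm_le_bound _ (norm_nonneg _) fun x'' => ?_
    refine NormedSpace.norm_le_dual_bound 𝕜 _ (by positivity) fun g => ?_
    rw [_root_.sub_apply, map_sub, dual_bidualTrunc, dual_bidualTrunc, ← map_sub,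
      ← ContinuousLinearMap.comp_sub]
    calc _ ≤ ‖x''‖ * ‖g.comp ((trunc 𝕜 p m).comp A - (trunc 𝕜 p n).comp A)‖ := x''.le_opNorm _
      _ ≤ ‖x''‖ * (‖g‖ * ‖(trunc 𝕜 p m).comp A - (trunc 𝕜 p n).comp A‖) := by
        gcongr
        exact g.opNorm_comp_le _
      _ = _ := by ring
  obtain ⟨A', hA'⟩ := exists_tendsto_of_norm_sub_le
    (W := Dual 𝕜 (Dual 𝕜 X) →L[𝕜] lp (fun _ : ℕ => 𝕜) p) (b := bidualTrunc A) hA hbound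
  refine ⟨A', hA', fun g x'' => ?_⟩
  have h1 : Tendsto (fun N => g (bidualTrunc A N x'')) atTop (𝓝 (g (A' x''))) :=
    (g.continuous.tendsto _).comp (((ContinuousLinearMap.apply 𝕜 _ x'').continuous.tendsto _).comp
      hA')
  have h2 : Tendsto (fun N => x'' (g.comp ((trunc 𝕜 p N).comp A))) atTop (𝓝 (x'' (g.comp A))) :=
    (x''.continuous.tendsto _).comp (tendsto_clm_comp tendsto_const_nhds hA)
  refine tendsto_nhds_unique h1 (h2.congr fun N => ?_)
  rw [dual_bidualTrunc]

lemma biadj_apply (T : X →L[𝕜] Y) (x'' : Dual 𝕜 (Dual 𝕜 X)) (y' : Dual 𝕜 Y) :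
    biadj T x'' y' = x'' (y'.comp T) := rfl

/-- `T** = B A'`, with `A'` the extension of `A` to `X**`: apply `x''` to the identity `y' ∘ T =
(π_{Y*} y') ∘ B ∘ A`. -/
theorem factorsCompactly_biadj_of_incl_comp {T : X →L[𝕜] Y}
    (h : FactorsCompactly p ((incl 𝕜 Y).comp T)) : FactorsCompactly p (biadj T) := by
  obtain ⟨A, B, hT, hA, hB⟩ := h.approxFactors
  obtain ⟨A', hA', hA'g⟩ := exists_bidual_extension hA
  refine ⟨A', B, isCompactOperator_of_tendsto hA' (Eventually.of_forall fun N =>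
      (isFiniteRank_bidualTrunc A N).isCompactOperator),
    isCompactOperator_of_tendsto hB (Eventually.of_forall fun N =>
      ((isFiniteRank_trunc N).clm_comp B).isCompactOperator), ?_⟩
  ext x'' y'
  have h1 := hA'g ((incl 𝕜 (Dual 𝕜 Y) y').comp B) x''
  rw [biadj_apply]
  refine Eq.trans ?_ h1.symm
  rw [ContinuousLinearMap.comp_assoc, ← hT]
  rfl

theorem factorsCompactly_incl_comp_of_biadj {T : X →L[𝕜] Y}
    (h : FactorsCompactly p (biadj T)) : FactorsCompactly p ((incl 𝕜 Y).comp T) := by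
  obtain ⟨A, B, hA, hB, hT⟩ := h
  refine ⟨A.comp (incl 𝕜 X), B, hA.comp_clm _, hB, ?_⟩
  rw [← ContinuousLinearMap.comp_assoc, ← hT]
  rfl

/-- A functional on `Y**` that vanishes on `π_Y Y` kills `π_Y T = B A`, hence `B A' x''`. As `Y` is
complete, `π_Y Y` is closed and Hahn–Banach applies. -/
lemma exists_incl_eq_of_incl_comp_eq [CompleteSpace Y] {T : X →L[𝕜] Y}
    {A : X →L[𝕜] lp (fun _ : ℕ => 𝕜) p} {B : lp (fun _ : ℕ => 𝕜) p →L[𝕜] Dual 𝕜 (Dual 𝕜 Y)}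
    (hT : (incl 𝕜 Y).comp T = B.comp A)
    {A' : Dual 𝕜 (Dual 𝕜 X) →L[𝕜] lp (fun _ : ℕ => 𝕜) p}
    (hA' : ∀ (g : Dual 𝕜 (lp (fun _ : ℕ => 𝕜) p)) x'', g (A' x'') = x'' (g.comp A))
    (x'' : Dual 𝕜 (Dual 𝕜 X)) : ∃ y, incl 𝕜 Y y = B (A' x'') := by
  by_contra hne
  obtain ⟨ψ, hψ, hψ0⟩ := exists_dual_ne_zero_of_notMem (isClosed_range_incl (𝕜 := 𝕜) (Y := Y))
    (z := B (A' x'')) (fun ⟨y, hy⟩ => hne ⟨y, hy⟩)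
  refine hψ0 ?_
  have h1 := hA' (ψ.comp B) x''
  rw [ContinuousLinearMap.comp_assoc, ← hT] at h1
  have h2 : ψ.comp ((incl 𝕜 Y).comp T) = 0 := by
    ext x
    exact hψ _ ⟨T x, rfl⟩
  rw [h2, map_zero] at h1
  exact h1

end Bidual

/-! ### Local reflexivity and local lifting by Helly's theorem -/

section LocalLifting

variable {𝕜 : Type*} [RCLike 𝕜] {p : ℝ≥0∞} [hp1 : Fact (1 ≤ p)]
variable {X : Type*} [NormedAddCommGroup X] [NormedSpace 𝕜 X]
variable {Y : Type*} [NormedAddCommGroup Y] [NormedSpace 𝕜 Y]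
variable {Z : Type*} [NormedAddCommGroup Z] [NormedSpace 𝕜 Z]
variable {H : Type*} [NormedAddCommGroup H] [NormedSpace 𝕜 H]

variable (𝕜) in
lemma exists_norming_net (F : Type*) [NormedAddCommGroup F] [NormedSpace 𝕜 F]
    [FiniteDimensional 𝕜 F] : ∃ t : Finset F, (∀ f ∈ t, ‖f‖ ≤ 1) ∧
      ∀ (D : F →L[𝕜] Z) (M : ℝ), 0 ≤ M → (∀ f ∈ t, ‖D f‖ ≤ M) → ‖D‖ ≤ 2 * M := by
  have : ProperSpace F := FiniteDimensional.proper 𝕜 F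
  obtain ⟨t, ht, htf, hcov⟩ := Metric.finite_approx_of_totallyBounded
    (isCompact_closedBall (0 : F) 1).totallyBounded (1 / 2) (by norm_num)
  refine ⟨htf.toFinset, fun f hf => by simpa using ht (htf.mem_toFinset.1 hf),
    fun D M hM h => ?_⟩
  have h1 : ‖D‖ ≤ M + ‖D‖ / 2 := by
    refine ContinuousLinearMap.opNorm_le_of_unit_norm (by positivity) fun x hx => ?_
    obtain ⟨f, hf, hxf⟩ := Set.mem_iUnion₂.1 (hcov (show x ∈ Metric.closedBall (0 : F) 1 by
      simp [hx]))
    rw [Metric.mem_ball, dist_eq_norm] at hxf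
    have h2 : D x = D f + D (x - f) := by rw [map_sub]; abel
    rw [h2]
    refine (norm_add_le _ _).trans (add_le_add (h f (htf.mem_toFinset.2 hf)) ?_)
    refine (D.le_opNorm _).trans ?_
    nlinarith [norm_nonneg D]
  linarith

/-- A linear system for a tuple in `Z` that has a solution in `Z**` of small `colOp`-norm has an
approximate solution in `Z` of comparable norm. -/
lemma exists_colOp_approx_solution {N : ℕ} (z'' : Fin N → Dual 𝕜 (Dual 𝕜 Z)) {β : ℝ} (hβ0 : 0 < β)
    (hβ : ∀ f : PiLp p (fun _ : Fin N => 𝕜), ‖∑ j, f j • z'' j‖ ≤ β * ‖f‖)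
    (R : (Fin N → Z) →L[𝕜] H) (h : H)
    (hR : ∀ φ : Dual 𝕜 H,
      ∑ j, z'' j ((φ.comp R).comp (ContinuousLinearMap.single 𝕜 (fun _ : Fin N => Z) j)) = φ h)
    {δ : ℝ} (hδ : 0 < δ) :
    ∃ z : Fin N → Z, ‖colOp (𝕜 := 𝕜) p z‖ ≤ 4 * β ∧ ‖R z - h‖ ≤ δ := by
  classical
  obtain ⟨t, ht, hnet⟩ := exists_norming_net 𝕜 (Z := Z) (PiLp p (fun _ : Fin N => 𝕜))
  let b : 𝕜 := ((β⁻¹ : ℝ) : 𝕜)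
  let d : 𝕜 := ((2 / δ : ℝ) : 𝕜)
  have hb : ‖b‖ = β⁻¹ := by
    rw [RCLike.norm_ofReal, abs_of_nonneg (by positivity)]
  have hd : ‖d‖ = 2 / δ := by
    rw [RCLike.norm_ofReal, abs_of_nonneg (by positivity)]
  let E : (f : t) → (Fin N → Z) →L[𝕜] Z := fun f =>
    ∑ j, (b * f.1 j) • ContinuousLinearMap.proj (R := 𝕜) (φ := fun _ : Fin N => Z) j
  have hE : ∀ f z, E f z = b • colOp p z f.1 := fun f z => by
    simp [E, colOp_apply, Finset.smul_sum, smul_smul]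
  -- One Helly problem encodes both demands: `β⁻¹ colOp z f` near 0 for `f` in the net, and `R z`
  -- near `h`, magnified by `2 / δ`. The tuple `z''` solves it up to 1, so some `z` solves it up to
  -- 2. The norming net costs a further factor 2, whence `4 β`.
  let R' : (Fin N → Z) →L[𝕜] (t → Z) × H := (ContinuousLinearMap.pi E).prod (d • R)
  let w'' : Dual 𝕜 (Fin N → Z) → 𝕜 := fun φ =>
    ∑ j, z'' j (φ.comp (ContinuousLinearMap.single 𝕜 (fun _ : Fin N => Z) j))
  have hw0 : w'' 0 = 0 := by simp [w'']
  have hw : ∀ φ : Dual 𝕜 ((t → Z) × H), ‖w'' (φ.comp R') - φ (0, d • h)‖ ≤ 1 * ‖φ‖ := by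
    intro φ
    let J : t → Z →L[𝕜] (t → Z) × H := fun f =>
      (ContinuousLinearMap.inl 𝕜 (t → Z) H).comp (ContinuousLinearMap.single 𝕜 (fun _ : t => Z) f)
    let φ₂ : Dual 𝕜 H := φ.comp (ContinuousLinearMap.inr 𝕜 (t → Z) H)
    have hdec : ∀ z, φ (R' z) = ∑ f, (φ.comp (J f)) (E f z) + d • φ₂ (R z) := fun z => by
      have h1 : R' z = ∑ f, J f (E f z) + ContinuousLinearMap.inr 𝕜 (t → Z) H (d • R z) := by
        refine Prod.ext ?_ ?_
        · ext f
          simp [R', J, Finset.sum_apply, Pi.single_apply, Prod.fst_sum]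
        · simp [R', J, Prod.snd_sum]
      rw [h1, map_add, map_sum, map_smul, map_smul]
      rfl
    have h1 : ∀ j, (φ.comp R').comp (ContinuousLinearMap.single 𝕜 (fun _ : Fin N => Z) j) =
        ∑ f : t, (b * f.1 j) • φ.comp (J f) +
          d • (φ₂.comp R).comp (ContinuousLinearMap.single 𝕜 (fun _ : Fin N => Z) j) := fun j => by
      ext z
      rw [ContinuousLinearMap.comp_apply, ContinuousLinearMap.comp_apply, hdec, _root_.add_apply,
        _root_.sum_apply]
      congr 1
      refine Finset.sum_congr rfl fun f _ => ?_
      rw [_root_.smul_apply, ← map_smul]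
      congr 1
      simp [E, Pi.single_apply]
    have h2 : w'' (φ.comp R') = ∑ f : t, b • (∑ j, f.1 j • z'' j) (φ.comp (J f)) +
        d • φ₂ h := by
      simp only [w'', h1, map_add, map_sum, map_smul, Finset.sum_add_distrib]
      rw [← hR φ₂, Finset.smul_sum, Finset.sum_comm]
      congr 1
      refine Finset.sum_congr rfl fun f _ => ?_
      rw [_root_.sum_apply, Finset.smul_sum]
      refine Finset.sum_congr rfl fun j _ => ?_
      rw [_root_.smul_apply, smul_smul]
    have h3 : φ (0, d • h) = d • φ₂ h := by
      rw [← map_smul]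
      rfl
    rw [h2, h3, add_sub_cancel_right, one_mul]
    refine (norm_sum_le _ _).trans ?_
    have h4 : ∀ f : t, ‖b • (∑ j, f.1 j • z'' j) (φ.comp (J f))‖ ≤ ‖φ.comp (J f)‖ := fun f => by
      rw [norm_smul, hb]
      have h5 := (∑ j, f.1 j • z'' j).le_of_opNorm_le (hβ f.1) (φ.comp (J f))
      have h6 := ht f.1 f.2
      rw [inv_mul_le_iff₀ hβ0]
      refine h5.trans ?_
      gcongr
      nlinarith
    refine (Finset.sum_le_sum fun f _ => h4 f).trans (sum_norm_comp_le Finset.univ J ?_ φ)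
    intro z hz
    have h5 : ∑ f, J f (z f) = (z, 0) := by
      refine Prod.ext ?_ ?_
      · ext f
        simp [J, Finset.sum_apply, Pi.single_apply, Prod.fst_sum]
      · simp [J, Prod.snd_sum]
    rw [h5, Prod.norm_mk, norm_zero]
    exact max_le ((pi_norm_le_iff_of_nonneg zero_le_one).2 hz) zero_le_one
  obtain ⟨z, hz⟩ := helly R' w'' hw0 (0, d • h) hw zero_le_one one_lt_two
  have hz1 : ∀ f : t, ‖E f z‖ ≤ 2 := fun f => by
    have h1 := (norm_fst_le (R' z - (0, d • h))).trans hz.le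
    refine le_trans ?_ ((norm_le_pi_norm _ f).trans h1)
    simp [R']
  have hz2 : ‖d • (R z - h)‖ ≤ 2 := by
    have h1 := (norm_snd_le (R' z - (0, d • h))).trans hz.le
    refine le_trans (le_of_eq ?_) h1
    simp [R', smul_sub]
  refine ⟨z, ?_, ?_⟩
  · refine (hnet (colOp p z) (2 * β) (by positivity) fun f hf => ?_).trans (by linarith)
    have h1 := hz1 ⟨f, hf⟩
    rw [hE, norm_smul, hb, inv_mul_le_iff₀ hβ0] at h1
    linarith
  · rw [norm_smul, hd, div_mul_eq_mul_div, div_le_iff₀ hδ] at hz2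
    linarith

lemma sum_single_eq {N : ℕ} {V : Type*} [NormedAddCommGroup V] [NormedSpace 𝕜 V]
    (φ : Dual 𝕜 (Fin N → V)) (h : Fin N → V) :
    φ h = ∑ l, (φ.comp (ContinuousLinearMap.single 𝕜 (fun _ : Fin N => V) l)) (h l) := by
  conv_lhs => rw [← Finset.univ_sum_single h]
  rw [map_sum]
  rfl

/-- A finite rank operator into `Y` that factors through `ℓ^p_N` into `Y**` also factors through
some `ℓ^p_M` into `Y`, with comparable norms. -/
theorem FinFactors.of_incl_comp {V : X →L[𝕜] Y} {c : ℝ} (hc : 0 < c)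
    (hV : FinFactors p ((incl 𝕜 Y).comp V) c) : FinFactors p V (5 * c) := by
  obtain ⟨N, A, B, hA, hBA, hAc, hBc⟩ := hV
  obtain ⟨L, v, x, hAx⟩ := hA.isFiniteRank.exists_eq_sum
  have hVx : V = ∑ l, (v l).smulRight (V (x l)) := by
    ext u
    refine incl_injective (𝕜 := 𝕜) ?_
    have h1 : ∀ w, incl 𝕜 Y (V w) = B (A w) := fun w => DFunLike.congr_fun hBA w
    rw [h1, hAx]
    simp only [_root_.sum_apply, ContinuousLinearMap.smulRight_apply, map_sum, map_smul, h1]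
  let z'' : Fin N → Dual 𝕜 (Dual 𝕜 Y) := fun j => B (lp.single p (j : ℕ) 1)
  have hz'' : ∀ f : PiLp p (fun _ : Fin N => 𝕜), ∑ j, f j • z'' j = B (inclFin 𝕜 p N f) := by
    intro f
    conv_rhs => rw [toLp_eq_sum f]
    simp only [map_sum, map_smul, inclFin_single, z'']
  -- The unknown columns `z` in `Y` should send `A (x l)` to `V (x l)`. In `Y**` the columns `z''`
  -- of `B` do so exactly.
  let R : (Fin N → Y) →L[𝕜] (Fin L → Y) := ContinuousLinearMap.pi fun l =>
    ∑ j : Fin N, (A (x l) j) • ContinuousLinearMap.proj (R := 𝕜) (φ := fun _ : Fin N => Y) j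
  have hR : ∀ z l, R z l = colOp p z (projFin 𝕜 p N (A (x l))) := fun z l => by
    rw [colOp_apply]
    simp [R, projFin_apply]
  have hproj : ∀ w, inclFin 𝕜 p N (projFin 𝕜 p N (A w)) = A w := fun w => by
    rw [← ContinuousLinearMap.comp_apply, inclFin_comp_projFin]
    exact trunc_eq_self (hA w)
  -- Small enough for the error `∑ v_l ⊗ (V x_l - colOp z (A x_l))` to factor with constant `c`;
  -- together with `4 c` this gives `5 c`.
  let δ : ℝ := c * c / (((∑ l, ‖v l‖) + 1) * (L + 1))
  have hδ : 0 < δ := by positivity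
  obtain ⟨z, hz1, hz2⟩ := exists_colOp_approx_solution (p := p) z'' hc (fun f => by
      rw [hz'']
      exact (B.le_of_opNorm_le hBc _).trans (by gcongr; exact norm_inclFin_apply_le N f))
    R (fun l => V (x l)) (fun φ => by
      rw [sum_single_eq φ]
      have h1 : ∀ j, (φ.comp R).comp (ContinuousLinearMap.single 𝕜 (fun _ : Fin N => Y) j) =
          ∑ l, A (x l) j • φ.comp (ContinuousLinearMap.single 𝕜 (fun _ : Fin L => Y) l) := by
        intro j
        ext y
        rw [ContinuousLinearMap.comp_apply, ContinuousLinearMap.comp_apply, sum_single_eq φ,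
          _root_.sum_apply]
        refine Finset.sum_congr rfl fun l _ => ?_
        rw [_root_.smul_apply, ← map_smul]
        congr 1
        simp [R, Pi.single_apply]
      simp only [h1, map_sum, map_smul]
      rw [Finset.sum_comm]
      refine Finset.sum_congr rfl fun l _ => ?_
      have h2 := DFunLike.congr_fun (hz'' (projFin 𝕜 p N (A (x l))))
        (φ.comp (ContinuousLinearMap.single 𝕜 (fun _ : Fin L => Y) l))
      rw [hproj, _root_.sum_apply] at h2
      have h3 : B (A (x l)) = incl 𝕜 Y (V (x l)) := (DFunLike.congr_fun hBA (x l)).symm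
      rw [h3, incl_apply] at h2
      exact h2) hδ
  have hdec : V = (colOp p z).comp ((projFin 𝕜 p N).comp A) +
      ∑ l, (v l).smulRight (V (x l) - colOp p z (projFin 𝕜 p N (A (x l)))) := by
    have h1 : (colOp p z).comp ((projFin 𝕜 p N).comp A) =
        ∑ l, (v l).smulRight (colOp p z (projFin 𝕜 p N (A (x l)))) := by
      ext u
      rw [ContinuousLinearMap.comp_apply, ContinuousLinearMap.comp_apply]
      conv_lhs => rw [hAx]
      simp only [_root_.sum_apply, ContinuousLinearMap.smulRight_apply, map_sum, map_smul]
    rw [h1, ← Finset.sum_add_distrib]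
    conv_lhs => rw [hVx]
    refine Finset.sum_congr rfl fun l _ => ?_
    ext u
    simp [smul_sub]
  rw [hdec]
  have h1 : FinFactors p ((colOp p z).comp ((projFin 𝕜 p N).comp A)) (4 * c) := by
    have : (colOp p z).comp ((projFin 𝕜 p N).comp A) = ((colOp p z).comp (projFin 𝕜 p N)).comp A :=
      rfl
    rw [this]
    exact ⟨N, A, _, hA, rfl, hAc.trans (by linarith), (norm_comp_projFin_le _).trans hz1⟩
  refine (h1.add (finFactors_sum_smulRight _ _ hc ?_)).mono (by linarith)
  have h2 : ∑ l, ‖V (x l) - colOp p z (projFin 𝕜 p N (A (x l)))‖ ≤ L * δ := by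
    refine (Finset.sum_le_card_nsmul _ _ δ fun l _ => ?_).trans (by simp)
    rw [norm_sub_rev, ← hR]
    exact (norm_le_pi_norm (R z - fun l => V (x l)) l).trans hz2
  calc _ ≤ ((∑ l, ‖v l‖) + 1) * ((L + 1) * δ) := by
        gcongr
        · linarith
        · exact h2.trans (by nlinarith)
    _ = c * c := by
        simp only [δ]
        field_simp

/-- Local lifting through a quotient map `q : Z → E` whose adjoint has a left inverse. -/
theorem exists_colOp_lift {E : Type*} [NormedAddCommGroup E] [NormedSpace 𝕜 E] (q : Z →L[𝕜] E)
    (hq : ∀ (e : E) (η : ℝ), ‖e‖ < η → ∃ z, q z = e ∧ ‖z‖ < η)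
    (r : Dual 𝕜 Z →L[𝕜] Dual 𝕜 E) (hr : ∀ g : Dual 𝕜 E, r (g.comp q) = g) {N : ℕ}
    (D : PiLp p (fun _ : Fin N => 𝕜) →L[𝕜] E) {β : ℝ} (hβ : 0 < β) (hD : ‖r‖ * ‖D‖ ≤ β) :
    ∃ B : PiLp p (fun _ : Fin N => 𝕜) →L[𝕜] Z, ‖B‖ ≤ 5 * β ∧ q.comp B = D := by
  let e : Fin N → E := fun j => D (WithLp.toLp p (Pi.single j 1))
  -- The adjoint of `r` lifts `e j` to `Z**`, because `q** r* = (r q*)*` is the identity.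
  let z'' : Fin N → Dual 𝕜 (Dual 𝕜 Z) := fun j => (incl 𝕜 E (e j)).comp r
  have hz'' : ∀ f : PiLp p (fun _ : Fin N => 𝕜), ∑ j, f j • z'' j = (incl 𝕜 E (D f)).comp r := by
    intro f
    conv_rhs => rw [toLp_eq_sum f]
    ext g
    simp [z'', e, _root_.sum_apply]
  let δ : ℝ := β / (N + 1) / 2
  have hδ : 0 < δ := by positivity
  obtain ⟨z, hz1, hz2⟩ := exists_colOp_approx_solution (p := p) z'' hβ (fun f => by
      rw [hz'']
      calc _ ≤ ‖incl 𝕜 E (D f)‖ * ‖r‖ := ContinuousLinearMap.opNorm_comp_le _ _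
        _ ≤ (‖D‖ * ‖f‖) * ‖r‖ := by
          gcongr
          rw [norm_incl]
          exact D.le_opNorm f
        _ = (‖r‖ * ‖D‖) * ‖f‖ := by ring
        _ ≤ _ := by gcongr)
    (ContinuousLinearMap.pi fun j =>
      q.comp (ContinuousLinearMap.proj (R := 𝕜) (φ := fun _ : Fin N => Z) j)) e (fun φ => by
      rw [sum_single_eq φ]
      refine Finset.sum_congr rfl fun j _ => ?_
      have h1 : (φ.comp (ContinuousLinearMap.pi fun j =>
          q.comp (ContinuousLinearMap.proj (R := 𝕜) (φ := fun _ : Fin N => Z) j))).comp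
            (ContinuousLinearMap.single 𝕜 (fun _ : Fin N => Z) j) =
          (φ.comp (ContinuousLinearMap.single 𝕜 (fun _ : Fin N => E) j)).comp q := by
        ext y
        simp only [ContinuousLinearMap.comp_apply]
        congr 1
        ext l
        by_cases hlj : l = j
        · subst hlj; simp
        · simp [hlj]
      rw [h1]
      change incl 𝕜 E (e j) (r _) = _
      rw [hr]
      rfl) hδ
  have hz3 : ∀ j, ‖e j - q (z j)‖ < 2 * δ := fun j => by
    rw [norm_sub_rev]
    have := (norm_le_pi_norm _ j).trans hz2
    exact lt_of_le_of_lt this (by linarith)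
  -- The lift so far is only approximate; `u` lifts the defects exactly, and `δ` was chosen so that
  -- `N * (2 * δ) ≤ β`.
  choose u hu hun using fun j => hq _ _ (hz3 j)
  refine ⟨colOp p z + colOp p u, (norm_add_le _ _).trans ?_, ?_⟩
  · have h1 : ‖colOp (𝕜 := 𝕜) p u‖ ≤ N * (2 * δ) := by
      refine ContinuousLinearMap.opNorm_le_bound _ (by positivity) fun f => ?_
      rw [colOp_apply]
      refine (norm_sum_le _ _).trans ((Finset.sum_le_card_nsmul _ _ (‖f‖ * (2 * δ))
        fun j _ => ?_).trans (le_of_eq ?_))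
      · rw [norm_smul]
        exact mul_le_mul (PiLp.norm_apply_le f j) (hun j).le (norm_nonneg _) (norm_nonneg _)
      · simp
        ring
    have h2 : N * (2 * δ) ≤ β := by
      have : 2 * δ = β / (N + 1) := by simp only [δ]; ring
      rw [this, mul_div_assoc', div_le_iff₀ (by positivity)]
      nlinarith
    linarith
  · rw [eq_colOp D]
    ext f
    simp only [ContinuousLinearMap.comp_apply, _root_.add_apply, colOp_apply, map_add, map_sum,
      map_smul, hu, ← Finset.sum_add_distrib, ← smul_add]
    refine Finset.sum_congr rfl fun j _ => ?_
    congr 1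
    simp [e]

end LocalLifting

/-! ### The approximation property passes from `E*` to `E` -/

section ApproximationProperty

variable {𝕜 : Type*} [RCLike 𝕜]
variable {E : Type*} [NormedAddCommGroup E] [NormedSpace 𝕜 E]
variable {G : Type*} [NormedAddCommGroup G] [NormedSpace 𝕜 G]

lemma HasAP.of_retract (h : HasAP 𝕜 E) (i : G →L[𝕜] E) (r : E →L[𝕜] G)
    (hri : ∀ x, r (i x) = x) : HasAP 𝕜 G := by
  intro K hK ε hε
  obtain ⟨S, hS, hSK⟩ := h (i '' K) (hK.image i.continuous) (ε / (‖r‖ + 1)) (by positivity)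
  refine ⟨r.comp (S.comp i), (hS.comp_clm i).clm_comp r, fun x hx => ?_⟩
  have h1 := hSK (i x) ⟨x, hx, rfl⟩
  have h2 : (r.comp (S.comp i)) x - x = r (S (i x) - i x) := by
    rw [map_sub, hri]
    rfl
  rw [h2]
  rw [lt_div_iff₀ (by positivity)] at h1
  refine lt_of_le_of_lt (r.le_opNorm _) (lt_of_le_of_lt ?_ h1)
  rw [mul_comm]
  gcongr
  linarith

variable (𝕜) in
/-- Every compact set is controlled by a family tending to zero. -/
lemma exists_null_family {K : Set E} (hK : IsCompact K) :
    ∃ x : ℕ × E × E → E, Tendsto x cofinite (𝓝 0) ∧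
      ∀ (D : E →L[𝕜] E) (η : ℝ), 0 ≤ η → (∀ i, ‖D (x i)‖ ≤ η) → ∀ y ∈ K, ‖D y‖ ≤ 2 * η := by
  classical
  obtain ⟨R, hR0, hR⟩ := hK.isBounded.exists_pos_norm_le
  have hnet : ∀ k : ℕ, ∃ t : Finset E, ∀ y ∈ K, ∃ u ∈ t, ‖y - u‖ ≤ R * (1 / 4) ^ k := fun k => by
    obtain ⟨t, -, htf, hcov⟩ := Metric.finite_approx_of_totallyBounded hK.totallyBounded
      (R * (1 / 4) ^ k) (by positivity)
    refine ⟨htf.toFinset, fun y hy => ?_⟩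
    obtain ⟨u, hu, hyu⟩ := Set.mem_iUnion₂.1 (hcov hy)
    rw [Metric.mem_ball, dist_eq_norm] at hyu
    exact ⟨u, htf.mem_toFinset.2 hu, hyu.le⟩
  choose t' ht' using hnet
  -- The net of radius `R` can be the origin alone, so every point of `K` is a telescoping sum
  -- starting at 0.
  let t : ℕ → Finset E := fun k => if k = 0 then {0} else t' k
  have ht : ∀ k, ∀ y ∈ K, ∃ u ∈ t k, ‖y - u‖ ≤ R * (1 / 4) ^ k := fun k y hy => by
    rcases Nat.eq_zero_or_pos k with rfl | hk
    · exact ⟨0, by simp [t], by simpa using hR y hy⟩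
    · simpa only [t, if_neg hk.ne'] using ht' k y hy
  -- Steps between consecutive nets have norm at most `2 R 4^-k`. Scaled by `2^k` they still tend to
  -- zero, and undoing the scaling costs `∑ 2^-k = 2`. Each `k` contributes finitely many nonzero
  -- terms.
  let x : ℕ × E × E → E := fun i =>
    if i.2.1 ∈ t i.1 ∧ i.2.2 ∈ t (i.1 + 1) ∧ ‖i.2.2 - i.2.1‖ ≤ 2 * R * (1 / 4) ^ i.1 then
      ((2 ^ i.1 : ℝ) : 𝕜) • (i.2.2 - i.2.1) else 0
  refine ⟨x, ?_, fun D η hη hD y hy => ?_⟩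
  · rw [Metric.tendsto_nhds]
    intro δ hδ
    have h1 : Tendsto (fun k : ℕ => 2 * R * (1 / 2) ^ k) atTop (𝓝 0) := by
      rw [← mul_zero (2 * R)]
      exact (tendsto_pow_atTop_nhds_zero_of_lt_one (by norm_num) (by norm_num)).const_mul _
    obtain ⟨k₀, hk₀⟩ := eventually_atTop.1 (h1.eventually (gt_mem_nhds hδ))
    refine ((Finset.range k₀).biUnion fun k =>
      {k} ×ˢ (t k ×ˢ t (k + 1))).finite_toSet.subset fun i hi => ?_
    simp only [Set.mem_compl_iff, Set.mem_ofPred_eq, dist_zero_right, not_lt] at hi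
    by_cases hc : i.2.1 ∈ t i.1 ∧ i.2.2 ∈ t (i.1 + 1) ∧ ‖i.2.2 - i.2.1‖ ≤ 2 * R * (1 / 4) ^ i.1
    · have hx : ‖x i‖ ≤ 2 * R * (1 / 2) ^ i.1 := by
        simp only [x, if_pos hc]
        rw [norm_smul, RCLike.norm_ofReal, abs_of_nonneg (by positivity)]
        calc (2 : ℝ) ^ i.1 * ‖i.2.2 - i.2.1‖ ≤ 2 ^ i.1 * (2 * R * (1 / 4) ^ i.1) := by
              gcongr
              exact hc.2.2
          _ = 2 * R * (2 ^ i.1 * (1 / 4) ^ i.1) := by ring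
          _ = _ := by
            rw [← mul_pow]
            norm_num
      have hlt : i.1 < k₀ := by
        by_contra hge
        exact absurd (hi.trans hx) (not_le.2 (hk₀ _ (not_lt.1 hge)))
      simp only [Finset.coe_biUnion, Set.mem_iUnion, Finset.coe_range, Set.mem_Iio]
      exact ⟨i.1, hlt, by simpa using ⟨i.2.1, i.2.2, ⟨hc.1, hc.2.1⟩, rfl⟩⟩
    · simp only [x, if_neg hc, norm_zero] at hi
      exact absurd hi (not_le.2 hδ)
  · choose u hut hu using fun k => ht k y hy
    have hu0 : u 0 = 0 := by
      have := hut 0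
      simpa [t] using this
    have hstep : ∀ k, ‖D (u (k + 1)) - D (u k)‖ ≤ η * (1 / 2) ^ k := fun k => by
      have h1 : ‖u (k + 1) - u k‖ ≤ 2 * R * (1 / 4) ^ k := by
        have h2 : u (k + 1) - u k = (y - u k) - (y - u (k + 1)) := by abel
        rw [h2]
        refine (norm_sub_le _ _).trans ?_
        have h3 := hu k
        have h4 := hu (k + 1)
        rw [pow_succ] at h4
        have h5 : (0 : ℝ) < R * (1 / 4) ^ k := by positivity
        nlinarith
      have h2 := hD (k, u k, u (k + 1))
      simp only [x] at h2
      rw [if_pos ⟨hut k, hut (k + 1), h1⟩, map_smul, norm_smul, RCLike.norm_ofReal,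
        abs_of_nonneg (by positivity), map_sub] at h2
      rw [one_div, inv_pow, ← div_eq_mul_inv, le_div_iff₀ (by positivity)]
      linarith
    have hbound : ∀ n, ‖D (u n)‖ ≤ η * (2 - 2 * (1 / 2) ^ n) := fun n => by
      induction n with
      | zero => simp [hu0]
      | succ n ih =>
        have h1 : D (u (n + 1)) = (D (u (n + 1)) - D (u n)) + D (u n) := by abel
        rw [h1]
        refine (norm_add_le _ _).trans ((add_le_add (hstep n) ih).trans (le_of_eq ?_))
        ring
    have hlim : Tendsto u atTop (𝓝 y) := by
      rw [tendsto_iff_norm_sub_tendsto_zero]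
      refine squeeze_zero (fun _ => norm_nonneg _) (fun k => (norm_sub_rev _ _).trans_le (hu k)) ?_
      rw [← mul_zero R]
      exact (tendsto_pow_atTop_nhds_zero_of_lt_one (by norm_num) (by norm_num)).const_mul _
    refine le_of_tendsto ((D.continuous.tendsto y).comp hlim).norm
      (Eventually.of_forall fun n => (hbound n).trans ?_)
    have : (0 : ℝ) < (1 / 2) ^ n := by positivity
    nlinarith

section NullFamilies

variable {ι : Type*} {x : ι → E}

lemma memℓp_infty_of_tendsto_cofinite (hx : Tendsto x cofinite (𝓝 0)) :
    Memℓp (E := fun _ : ι => E) x ∞ := by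
  refine memℓp_infty ?_
  have h1 := hx.isCompact_insert_range_of_cofinite.isBounded.subset (Set.subset_insert _ _)
  obtain ⟨C, hC⟩ := isBounded_iff_forall_norm_le.1 h1
  exact ⟨C, by rintro _ ⟨i, rfl⟩; exact hC _ (Set.mem_range_self i)⟩

lemma hasSum_single_of_tendsto_cofinite [DecidableEq ι] (w : lp (fun _ : ι => E) ∞)
    (hw : Tendsto (fun i => w i) cofinite (𝓝 0)) :
    HasSum (fun i => lp.single ∞ i (w i)) w := by
  rw [HasSum, SummationFilter.unconditional_filter, Metric.tendsto_atTop]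
  intro ε hε
  have hfin : {i | ¬ dist (w i) 0 < ε / 2}.Finite := Metric.tendsto_nhds.1 hw (ε / 2) (half_pos hε)
  refine ⟨hfin.toFinset, fun s hs => ?_⟩
  rw [dist_eq_norm]
  refine lt_of_le_of_lt (lp.norm_le_of_forall_le (half_pos hε).le fun i => ?_) (half_lt_self hε)
  rw [lp.coeFn_sub, Pi.sub_apply, lp.coeFn_sum, Finset.sum_apply]
  simp only [lp.single_apply, Pi.single_apply]
  rw [Finset.sum_ite_eq s i (fun j => w j)]
  split_ifs with h
  · simpa using (half_pos hε).le
  · have : i ∉ hfin.toFinset := fun hi => h (hs hi)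
    simp only [Set.Finite.mem_toFinset, Set.mem_ofPred_eq, not_not, dist_zero_right] at this
    simpa using this.le

lemma norm_sum_single_le [DecidableEq ι] (s : Finset ι) {z : ι → E} (hz : ∀ i, ‖z i‖ ≤ 1) :
    ‖∑ i ∈ s, (lp.single ∞ i (z i) : lp (fun _ : ι => E) ∞)‖ ≤ 1 := by
  refine lp.norm_le_of_forall_le zero_le_one fun i => ?_
  rw [lp.coeFn_sum, Finset.sum_apply]
  simp only [lp.single_apply, Pi.single_apply]
  rw [Finset.sum_ite_eq s i (fun j => z j)]
  split_ifs
  · exact hz i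
  · simp

end NullFamilies

/-- If the dual of `E` has the approximation property, then so does `E`. -/
theorem HasAP.of_dual (h : HasAP 𝕜 (Dual 𝕜 E)) : HasAP 𝕜 E := by
  classical
  intro K hK ε hε
  obtain ⟨x, hx, hxK⟩ := exists_null_family 𝕜 hK
  suffices hS : ∃ S : E →L[𝕜] E, IsFiniteRank S ∧ ∀ i, ‖S (x i) - x i‖ ≤ ε / 3 by
    obtain ⟨S, hS, hSx⟩ := hS
    refine ⟨S, hS, fun y hy => ?_⟩
    have h1 := hxK (S - ContinuousLinearMap.id 𝕜 E) (ε / 3) (by positivity) hSx y hy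
    exact lt_of_le_of_lt h1 (by linarith)
  let W := lp (fun _ : ℕ × E × E => E) ∞
  have hnull : ∀ S : E →L[𝕜] E, Tendsto (fun i => S (x i)) cofinite (𝓝 0) := fun S => by
    have h1 := (S.continuous.tendsto 0).comp hx
    rwa [map_zero] at h1
  let seq : (E →L[𝕜] E) → W := fun S => ⟨fun i => S (x i),
    memℓp_infty_of_tendsto_cofinite (hnull S)⟩
  let x₀ : W := ⟨x, memℓp_infty_of_tendsto_cofinite hx⟩
  let M : Submodule 𝕜 W :=
    { carrier := {w | ∃ S : E →L[𝕜] E, IsFiniteRank S ∧ w = seq S}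
      add_mem' := by
        rintro _ _ ⟨S, hS, rfl⟩ ⟨T, hT, rfl⟩
        exact ⟨S + T, hS.add hT, lp.ext (by ext i; rfl)⟩
      zero_mem' := ⟨0, IsFiniteRank.of_mem ⊥ fun _ => rfl, lp.ext (by ext i; rfl)⟩
      smul_mem' := by
        rintro c _ ⟨S, hS, rfl⟩
        refine ⟨(c • ContinuousLinearMap.id 𝕜 E).comp S, hS.clm_comp _, lp.ext (by ext i; rfl)⟩ }
  -- Separation in the space of bounded families: it remains to see that this `ψ`, which vanishes on
  -- all `(S x_i)` with `S` of finite rank, vanishes at `(x_i)`.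
  obtain ⟨ψ, -, hψM, hψx⟩ := exists_dual_vanishing M x₀
  suffices h0 : ψ x₀ = 0 by
    rw [h0] at hψx
    have h1 : ‖M.mkQ x₀‖ = 0 := by exact_mod_cast hψx.symm
    obtain ⟨_, ⟨S, hS, rfl⟩, hlt⟩ := exists_norm_sub_lt_of_mkQ M x₀ (r := ε / 3)
      (h1.trans_lt (by positivity))
    refine ⟨S, hS, fun i => ?_⟩
    exact (lp.norm_apply_le_norm ENNReal.top_ne_zero (seq S - x₀) i).trans hlt.le
  let φ : ℕ × E × E → Dual 𝕜 E := fun i =>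
    ψ.comp (lp.singleContinuousLinearMap 𝕜 (fun _ : ℕ × E × E => E) ∞ i)
  have hφs : Summable fun i => ‖φ i‖ := by
    refine summable_of_sum_le (c := ‖ψ‖) (fun _ => norm_nonneg _) fun s => ?_
    refine sum_norm_comp_le s _ (fun z hz => ?_) ψ
    exact norm_sum_single_le s hz
  have hsum : ∀ w : W, Tendsto (fun i => w i) cofinite (𝓝 0) →
      HasSum (fun i => φ i (w i)) (ψ w) := fun w hw =>
    (hasSum_single_of_tendsto_cofinite w hw).mapL ψ
  obtain ⟨b, hb0, hb⟩ : ∃ b : ℝ, 0 ≤ b ∧ ∀ i, ‖x i‖ ≤ b :=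
    ⟨‖x₀‖, norm_nonneg _, fun i => lp.norm_apply_le_norm ENNReal.top_ne_zero x₀ i⟩
  -- On null families `ψ` is the summable family `φ`. Testing it on the rank one operators `f ⊗ e`
  -- gives this identity in `E*`.
  have hrank1 : ∀ f : Dual 𝕜 E, HasSum (fun i => f (x i) • φ i) 0 := fun f => by
    have h1 : Summable fun i => f (x i) • φ i := by
      refine Summable.of_norm_bounded (hφs.mul_left (‖f‖ * b)) fun i => ?_
      rw [norm_smul]
      gcongr
      exact (f.le_opNorm _).trans (by gcongr; exact hb i)
    have h2 : ∑' i, f (x i) • φ i = 0 := by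
      ext e
      have h3 := (h1.hasSum).mapL (ContinuousLinearMap.apply 𝕜 𝕜 e)
      have hfin : IsFiniteRank (f.smulRight e) := by
        simpa using isFiniteRank_sum_smulRight (n := 1) (fun _ => f) (fun _ => e)
      have h4 := hsum (seq (f.smulRight e)) (hnull _)
      rw [hψM _ ⟨_, hfin, rfl⟩] at h4
      refine h3.unique (h4.congr_fun fun i => ?_)
      change f (x i) • φ i e = φ i (f (x i) • e)
      rw [map_smul]
    rw [← h2]
    exact h1.hasSum
  -- Nonzero `φ i` are rescaled to norm `√‖x i‖`, which makes a null family; the other factor `√‖x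
  -- i‖` of `‖x i‖` stays bounded by `√b`.
  let φ' : ℕ × E × E → Dual 𝕜 E := fun i => ((√‖x i‖ / ‖φ i‖ : ℝ) : 𝕜) • φ i
  have hφ' : Tendsto φ' cofinite (𝓝 0) := by
    have h1 : Tendsto (fun i => √‖x i‖) cofinite (𝓝 0) := by
      have h2 := (Real.continuous_sqrt.tendsto 0).comp (tendsto_zero_iff_norm_tendsto_zero.1 hx)
      rwa [Real.sqrt_zero] at h2
    refine squeeze_zero_norm (fun i => ?_) h1
    rw [norm_smul, RCLike.norm_ofReal, abs_of_nonneg (by positivity)]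
    rcases eq_or_ne ‖φ i‖ 0 with h0 | h0
    · rw [h0, mul_zero]
      positivity
    · rw [div_mul_cancel₀ _ h0]
  have hmain : ∀ δ : ℝ, 0 < δ → ‖ψ x₀‖ ≤ δ * (√b * ∑' i, ‖φ i‖) := fun δ hδ => by
    obtain ⟨S, hS, hSφ⟩ := h _ hφ'.isCompact_insert_range_of_cofinite δ hδ
    -- For `S` of finite rank this is a finite combination of the identities `hrank1`. So `-ψ x₀` is
    -- the sum of the small terms `(S φ_i - φ_i)(x_i)`.
    have hzero : HasSum (fun i => S (φ i) (x i)) 0 := by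
      obtain ⟨n, F, g, hSg⟩ := hS.exists_eq_sum
      have h1 : HasSum (fun i => ∑ k, F k (S (g k) (x i) • φ i)) 0 := by
        have := hasSum_sum (s := Finset.univ) fun k _ => (hrank1 (S (g k))).mapL (F k)
        simpa using this
      refine h1.congr_fun fun i => ?_
      conv_lhs => rw [hSg]
      rw [_root_.sum_apply, _root_.sum_apply]
      refine Finset.sum_congr rfl fun k _ => ?_
      rw [map_smul, ContinuousLinearMap.smulRight_apply, _root_.smul_apply, smul_eq_mul,
        smul_eq_mul, mul_comm]
    have hdiff := (hzero.sub (hsum x₀ hx))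
    rw [zero_sub] at hdiff
    have h2 := hdiff.norm_le_of_bounded ((hφs.hasSum).mul_left (δ * √b)) fun i => ?_
    · rw [norm_neg] at h2
      linarith
    rw [← _root_.sub_apply]
    rcases eq_or_ne (φ i) 0 with h0 | h0
    · rw [h0, map_zero, sub_zero]
      simp
    rcases eq_or_ne (x i) 0 with hx0 | hx0
    · change ‖(S (φ i) - φ i) (x i)‖ ≤ _
      rw [hx0, map_zero, norm_zero]
      positivity
    have h3 := hSφ (φ' i) (Set.mem_insert_of_mem _ (Set.mem_range_self i))
    have hxp : 0 < ‖x i‖ := norm_pos_iff.2 hx0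
    have hφp : 0 < ‖φ i‖ := norm_pos_iff.2 h0
    have h4 : S (φ' i) - φ' i = ((√‖x i‖ / ‖φ i‖ : ℝ) : 𝕜) • (S (φ i) - φ i) := by
      rw [smul_sub, ← map_smul]
    rw [h4, norm_smul, RCLike.norm_ofReal, abs_of_nonneg (by positivity),
      div_mul_eq_mul_div, div_lt_iff₀ hφp] at h3
    calc ‖(S (φ i) - φ i) (x i)‖ ≤ ‖S (φ i) - φ i‖ * ‖x i‖ := ContinuousLinearMap.le_opNorm _ _
      _ = (√‖x i‖ * ‖S (φ i) - φ i‖) * √‖x i‖ := by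
        conv_lhs => rw [← Real.mul_self_sqrt hxp.le]
        ring
      _ ≤ (δ * ‖φ i‖) * √b := by
        gcongr
        exact hb i
      _ = _ := by ring
  have hC : 0 ≤ √b * ∑' i, ‖φ i‖ := by positivity
  rw [← norm_le_zero_iff]
  refine le_of_forall_pos_le_add fun δ hδ => ?_
  refine (hmain (δ / (√b * ∑' i, ‖φ i‖ + 1)) (by positivity)).trans ?_
  rw [zero_add, div_mul_eq_mul_div, div_le_iff₀ (by positivity)]
  nlinarith

end ApproximationProperty

/-! ### Finite rank approximation with values in `Y` -/

section Approximation

variable {𝕜 : Type*} [RCLike 𝕜] {p : ℝ≥0∞} [hp1 : Fact (1 ≤ p)]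
variable {X : Type*} [NormedAddCommGroup X] [NormedSpace 𝕜 X]
variable {Y : Type*} [NormedAddCommGroup Y] [NormedSpace 𝕜 Y] [CompleteSpace Y]

lemma eventually_finFactors_sum_smulRight {Z : Type*} [NormedAddCommGroup Z] [NormedSpace 𝕜 Z]
    {n : ℕ} {v : ℕ → Fin n → Dual 𝕜 X} {z : ℕ → Fin n → Z} {ε : ℝ} (hε : 0 < ε)
    (h : Tendsto (fun N => (∑ j, ‖v N j‖) * ∑ j, ‖z N j‖) atTop (𝓝 0)) :
    ∀ᶠ N in atTop, FinFactors p (∑ j, (v N j).smulRight (z N j)) ε := by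
  filter_upwards [h.eventually (gt_mem_nhds (mul_pos hε hε))] with N hN
  exact finFactors_sum_smulRight _ _ hε hN.le

omit [CompleteSpace Y] in
lemma norm_adj_sub_le {Z : Type*} [NormedAddCommGroup Z] [NormedSpace 𝕜 Z] (S T : X →L[𝕜] Z) :
    ‖adj S - adj T‖ ≤ ‖S - T‖ := by
  refine ContinuousLinearMap.opNorm_le_bound _ (norm_nonneg _) fun g => ?_
  have h1 : (adj S - adj T) g = g.comp (S - T) := by
    ext x
    simp [adj]
  rw [h1, mul_comm]
  exact g.opNorm_comp_le _

lemma tendsto_of_norm_sub_le {V W : Type*} [NormedAddCommGroup V] [NormedAddCommGroup W]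
    {a : ℕ → V} {a₀ : V} (ha : Tendsto a atTop (𝓝 a₀)) {b : ℕ → W} {b₀ : W}
    (h : ∀ n, ‖b n - b₀‖ ≤ ‖a n - a₀‖) : Tendsto b atTop (𝓝 b₀) := by
  rw [tendsto_iff_norm_sub_tendsto_zero] at ha ⊢
  exact squeeze_zero (fun _ => norm_nonneg _) h ha

lemma isCompactOperator_adj {A : X →L[𝕜] lp (fun _ : ℕ => 𝕜) p}
    (hA : Tendsto (fun N => (trunc 𝕜 p N).comp A) atTop (𝓝 A)) : IsCompactOperator (adj A) := by
  have h1 : Tendsto (fun N => adj ((trunc 𝕜 p N).comp A)) atTop (𝓝 (adj A)) :=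
    tendsto_of_norm_sub_le (W := Dual 𝕜 (lp (fun _ : ℕ => 𝕜) p) →L[𝕜] Dual 𝕜 X)
      (b := fun N => adj ((trunc 𝕜 p N).comp A)) hA fun N => norm_adj_sub_le _ _
  refine isCompactOperator_of_tendsto h1 (Eventually.of_forall fun N => ?_)
  let s : Set (Dual 𝕜 X) :=
    (fun j => (lp.evalCLM 𝕜 (fun _ : ℕ => 𝕜) p j).comp A) '' (Finset.range N : Set ℕ)
  have : FiniteDimensional 𝕜 (Submodule.span 𝕜 s) :=
    FiniteDimensional.span_of_finite 𝕜 ((Finset.finite_toSet _).image _)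
  refine (IsFiniteRank.of_mem (Submodule.span 𝕜 s) fun g => ?_).isCompactOperator
  have h2 : adj ((trunc 𝕜 p N).comp A) g = g.comp ((trunc 𝕜 p N).comp A) := rfl
  rw [h2, dual_trunc_comp]
  exact Submodule.sum_mem _ fun j hj =>
    Submodule.smul_mem _ _ (Submodule.subset_span ⟨j, hj, rfl⟩)

lemma bidualTrunc_apply_eq_zero (A : X →L[𝕜] lp (fun _ : ℕ => 𝕜) p) {N k : ℕ} (hk : N ≤ k)
    (x'' : Dual 𝕜 (Dual 𝕜 X)) : bidualTrunc A N x'' k = 0 := by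
  have h := dual_bidualTrunc A N (lp.evalCLM 𝕜 (fun _ : ℕ => 𝕜) p k) x''
  have h2 : (lp.evalCLM 𝕜 (fun _ : ℕ => 𝕜) p k).comp ((trunc 𝕜 p N).comp A) = 0 := by
    ext x
    exact supportedBelow_trunc_comp A N x k hk
  rw [h2, map_zero] at h
  exact h

/-- `A*` maps the unit ball into a compact `K`, on which the identity of `X*` is nearly `S = ∑ F_i ⊗
S g_i` with `F_i` in `X**`. Then `∑ S g_i ⊗ A' F_i` is close to `A`, and `B A' F_i` lies in `π_Y Y`.
-/
theorem exists_finiteRank_approx_of_dual (hAP : HasAP 𝕜 (Dual 𝕜 X)) {T : X →L[𝕜] Y}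
    {A : X →L[𝕜] lp (fun _ : ℕ => 𝕜) p} {B : lp (fun _ : ℕ => 𝕜) p →L[𝕜] Dual 𝕜 (Dual 𝕜 Y)}
    (hT : (incl 𝕜 Y).comp T = B.comp A)
    (hA : Tendsto (fun N => (trunc 𝕜 p N).comp A) atTop (𝓝 A)) {ε : ℝ} (hε : 0 < ε) :
    ∃ S : X →L[𝕜] Y, IsFiniteRank S ∧
      ∀ᶠ N in atTop, FinFactors p ((incl 𝕜 Y).comp S - B.comp ((trunc 𝕜 p N).comp A)) ε := by
  obtain ⟨K, hK, hKA⟩ := exists_isCompact_of_isCompactOperator (isCompactOperator_adj hA)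
  have hη : 0 < ε / 2 * (ε / 2) / (‖B‖ + 1) := by positivity
  obtain ⟨S, hS, hSK⟩ := hAP K hK _ hη
  set η := ε / 2 * (ε / 2) / (‖B‖ + 1) with hηdef
  obtain ⟨n, F, g, hSF⟩ := hS.exists_eq_sum
  obtain ⟨A', hA't, hA'⟩ := exists_bidual_extension hA
  choose y hy using fun i => exists_incl_eq_of_incl_comp_eq hT hA' (F i)
  refine ⟨∑ i, (S (g i)).smulRight (y i), isFiniteRank_sum_smulRight _ _, ?_⟩
  -- The truncated approximant factors through `ℓ^p_N`. Its distance to `trunc_N A` is at most `η`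
  -- for every `N`, as `f ∘ trunc_N ∘ A` stays in `K` for `‖f‖ ≤ 1`.
  let R : ℕ → X →L[𝕜] lp (fun _ : ℕ => 𝕜) p := fun N =>
    ∑ i, (S (g i)).smulRight (bidualTrunc A N (F i))
  have hR : ∀ N (f : Dual 𝕜 (lp (fun _ : ℕ => 𝕜) p)) x,
      f (R N x) = S (f.comp ((trunc 𝕜 p N).comp A)) x := fun N f x => by
    conv_rhs => rw [hSF]
    simp only [R, _root_.sum_apply, map_sum, ContinuousLinearMap.smulRight_apply, map_smul,
      dual_bidualTrunc, _root_.smul_apply, smul_eq_mul, mul_comm]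
  have hRnorm : ∀ N, ‖R N - (trunc 𝕜 p N).comp A‖ ≤ η := fun N => by
    refine ContinuousLinearMap.opNorm_le_bound _ hη.le fun x => ?_
    obtain ⟨f, hf, hfx⟩ := exists_dual_vector'' 𝕜 ((R N - (trunc 𝕜 p N).comp A) x)
    have h1 : ‖f ((R N - (trunc 𝕜 p N).comp A) x)‖ ≤ η * ‖x‖ := by
      have hmem : f.comp ((trunc 𝕜 p N).comp A) ∈ K :=
        hKA (f.comp (trunc 𝕜 p N)) ((opNorm_comp_le_left f (norm_trunc_le N)).trans hf)
      have h2 : f ((R N - (trunc 𝕜 p N).comp A) x) =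
          (S (f.comp ((trunc 𝕜 p N).comp A)) - f.comp ((trunc 𝕜 p N).comp A)) x := by
        rw [_root_.sub_apply, map_sub, hR]
        rfl
      rw [h2]
      exact ContinuousLinearMap.le_of_opNorm_le _ (hSK _ hmem).le x
    rwa [hfx, RCLike.norm_ofReal, abs_of_nonneg (norm_nonneg _)] at h1
  have hRsupp : ∀ N, SupportedBelow (R N) N := fun N x k hk => by
    simp only [R, _root_.sum_apply, ContinuousLinearMap.smulRight_apply]
    rw [lp.coeFn_sum, Finset.sum_apply]
    refine Finset.sum_eq_zero fun i _ => ?_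
    rw [lp.coeFn_smul, Pi.smul_apply, bidualTrunc_apply_eq_zero A hk, smul_zero]
  have hlim : Tendsto (fun N => (∑ i, ‖S (g i)‖) *
      ∑ i, ‖B (A' (F i)) - B (bidualTrunc A N (F i))‖) atTop (𝓝 0) := by
    have h1 : ∀ i, Tendsto (fun N => ‖B (A' (F i)) - B (bidualTrunc A N (F i))‖) atTop (𝓝 0) := by
      intro i
      have h2 : Tendsto (fun N => bidualTrunc A N (F i)) atTop (𝓝 (A' (F i))) :=
        ((ContinuousLinearMap.apply 𝕜 _ (F i)).continuous.tendsto _).comp hA't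
      have h3 := (tendsto_const_nhds (x := B (A' (F i)))).sub ((B.continuous.tendsto _).comp h2)
      rw [sub_self] at h3
      simpa using h3.norm
    simpa using (tendsto_finsetSum Finset.univ fun i _ => h1 i).const_mul (∑ i, ‖S (g i)‖)
  filter_upwards [eventually_finFactors_sum_smulRight (p := p) (v := fun _ i => S (g i))
    (z := fun N i => B (A' (F i)) - B (bidualTrunc A N (F i))) (half_pos hε) hlim] with N hN
  have hdec : (incl 𝕜 Y).comp (∑ i, (S (g i)).smulRight (y i)) - B.comp ((trunc 𝕜 p N).comp A) =
      ∑ i, (S (g i)).smulRight (B (A' (F i)) - B (bidualTrunc A N (F i))) +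
        B.comp (R N - (trunc 𝕜 p N).comp A) := by
    ext1 x
    simp only [ContinuousLinearMap.comp_apply, _root_.sub_apply, _root_.add_apply,
      _root_.sum_apply, map_sum, map_sub, ContinuousLinearMap.smulRight_apply, map_smul, hy, R,
      smul_sub, Finset.sum_sub_distrib]
    abel
  rw [hdec]
  refine (hN.add (finFactors_of_mul_le
    ((hRsupp N).sub (supportedBelow_trunc_comp A N)) (half_pos hε) ?_)).mono (by linarith)
  calc _ ≤ η * (‖B‖ + 1) := by
        gcongr
        · exact hRnorm N
        · linarith
    _ = _ := by
        rw [hηdef]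
        field_simp

omit hp1 [CompleteSpace Y] in
lemma exists_colOp_eq {Z : Type*} [NormedAddCommGroup Z] [NormedSpace 𝕜 Z] {N : ℕ} (i : Y →L[𝕜] Z)
    (V : PiLp p (fun _ : Fin N => 𝕜) →L[𝕜] Z) (hV : ∀ f, ∃ y, i y = V f) :
    ∃ y : Fin N → Y, ∀ f, i (colOp (𝕜 := 𝕜) p y f) = V f := by
  choose y hy using fun j : Fin N => hV (WithLp.toLp p (Pi.single j 1))
  refine ⟨y, fun f => ?_⟩
  rw [eq_colOp V, colOp_apply, colOp_apply, map_sum]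
  exact Finset.sum_congr rfl fun j _ => by rw [map_smul, hy]

omit [CompleteSpace Y] in
/-- Finite-rank approximation of `B A` with values in the subspace `Y` of `Z`, when the quotient
`E` of `Z` by `Y` has the approximation property and operators from `ℓ^p_n` to `E` lift to `Z`. -/
theorem exists_finiteRank_approx_of_lift {E : Type*} [NormedAddCommGroup E] [NormedSpace 𝕜 E]
    {Z : Type*} [NormedAddCommGroup Z] [NormedSpace 𝕜 Z] [CompleteSpace Z]
    (hE : HasAP 𝕜 E) (i : Y →L[𝕜] Z) (q : Z →L[𝕜] E) (hker : ∀ z, q z = 0 ↔ ∃ y, i y = z)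
    (hq : Function.Surjective q) {ρ : ℝ} (hρ : 0 ≤ ρ)
    (hlift : ∀ (N : ℕ) (D : PiLp p (fun _ : Fin N => 𝕜) →L[𝕜] E) (β : ℝ), 0 < β → ρ * ‖D‖ ≤ β →
      ∃ D' : PiLp p (fun _ : Fin N => 𝕜) →L[𝕜] Z, ‖D'‖ ≤ 5 * β ∧ q.comp D' = D)
    {T : X →L[𝕜] Y}
    {A : X →L[𝕜] lp (fun _ : ℕ => 𝕜) p} {B : lp (fun _ : ℕ => 𝕜) p →L[𝕜] Z}
    (hT : i.comp T = B.comp A)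
    (hA : Tendsto (fun N => (trunc 𝕜 p N).comp A) atTop (𝓝 A))
    (hB : Tendsto (fun N => B.comp (trunc 𝕜 p N)) atTop (𝓝 B)) {ε : ℝ} (hε : 0 < ε) :
    ∃ S : X →L[𝕜] Y, IsFiniteRank S ∧
      ∀ᶠ N in atTop, FinFactors p (i.comp S - B.comp ((trunc 𝕜 p N).comp A)) ε := by
  set c := ε / 3 with hc
  have hc0 : 0 < c := by positivity
  have hβ0 : 0 < c * c / (5 * (‖A‖ + 1)) := by positivity
  set β := c * c / (5 * (‖A‖ + 1)) with hβ
  have hBc : IsCompactOperator B := isCompactOperator_of_tendsto hB (Eventually.of_forall fun N =>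
    ((isFiniteRank_trunc N).clm_comp B).isCompactOperator)
  obtain ⟨K, hK, hKB⟩ := exists_isCompact_of_isCompactOperator (A := q.comp B) (hBc.clm_comp q)
  have hη : 0 < β / (ρ + 1) := by positivity
  obtain ⟨S, hS, hSK⟩ := hE K hK _ hη
  obtain ⟨n, e', x, hSx⟩ := hS.exists_eq_sum
  choose e he using fun l => hq (S (x l))
  let L : Z →L[𝕜] Z := ∑ l, ((e' l).comp q).smulRight (e l)
  have hqL : ∀ z, q (L z) = S (q z) := fun z => by
    conv_rhs => rw [hSx]
    simp [L, _root_.sum_apply, he]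
  -- `L` is a finite rank lift of `S`, so `q B' = q B - S q B` is small. On `ℓ^p_{N₀}` it will be
  -- lifted to a small `B₂`; then `B' - B₂` has values in `ker q = i(Y)`. As `N₀` depends on `B'`,
  -- the bound on the lift must not depend on `N₀`.
  let B' : lp (fun _ : ℕ => 𝕜) p →L[𝕜] Z := B - L.comp B
  have hqB' : ‖q.comp B'‖ ≤ β / (ρ + 1) := by
    refine ContinuousLinearMap.opNorm_le_of_unit_norm hη.le fun w hw => ?_
    have h1 : (q.comp B') w = -(S (q (B w)) - q (B w)) := by
      rw [← hqL]
      simp [B']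
    rw [h1, norm_neg]
    exact (hSK _ (hKB w hw.le)).le
  obtain ⟨N₀, hN₀⟩ := Metric.cauchySeq_iff'.1 hA.cauchySeq (c * c / (‖B'‖ + 1)) (by positivity)
  let D : PiLp p (fun _ : Fin N₀ => 𝕜) →L[𝕜] E := (q.comp B').comp (inclFin 𝕜 p N₀)
  have hD : ρ * ‖D‖ ≤ β := by
    have h1 : ‖D‖ ≤ β / (ρ + 1) := (norm_comp_inclFin_le _).trans hqB'
    calc ρ * ‖D‖ ≤ (ρ + 1) * (β / (ρ + 1)) := by
          gcongr
          linarith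
      _ = β := by field_simp
  obtain ⟨B₂, hB₂, hqB₂⟩ := hlift N₀ D β hβ0 hD
  let V : PiLp p (fun _ : Fin N₀ => 𝕜) →L[𝕜] Z := B'.comp (inclFin 𝕜 p N₀) - B₂
  obtain ⟨y, hcol⟩ := exists_colOp_eq i V fun f => (hker _).1 (by
    have h1 : q (B₂ f) = q (B' (inclFin 𝕜 p N₀ f)) := DFunLike.congr_fun hqB₂ f
    change q (B' (inclFin 𝕜 p N₀ f) - B₂ f) = 0
    rw [map_sub, h1, sub_self])
  refine ⟨(colOp p y).comp ((projFin 𝕜 p N₀).comp A), ?_, ?_⟩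
  · exact IsFiniteRank.clm_comp (S := (projFin 𝕜 p N₀).comp A)
      (inferInstanceAs (FiniteDimensional 𝕜 (LinearMap.range _))) _
  -- This is the error `L B trunc_N A`. Its rank is fixed and its functionals tend to zero, because
  -- `q B A = q i T = 0`.
  have hL : ∀ᶠ N in atTop,
      FinFactors p (∑ l, ((e' l).comp (q.comp (B.comp ((trunc 𝕜 p N).comp A)))).smulRight (e l))
        c := by
    refine eventually_finFactors_sum_smulRight hc0 ?_
    have h1 : ∀ l, Tendsto (fun N => ‖(e' l).comp (q.comp (B.comp ((trunc 𝕜 p N).comp A)))‖)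
        atTop (𝓝 0) := fun l => by
      have h2 : Tendsto (fun N => (e' l).comp (q.comp (B.comp ((trunc 𝕜 p N).comp A)))) atTop
          (𝓝 ((e' l).comp (q.comp (B.comp A)))) :=
        tendsto_clm_comp tendsto_const_nhds
          (tendsto_clm_comp tendsto_const_nhds (tendsto_comp_trunc_comp B hA))
      have h3 : (e' l).comp (q.comp (B.comp A)) = 0 := by
        rw [← hT]
        ext u
        have : q (i (T u)) = 0 := (hker _).2 ⟨_, rfl⟩
        change e' l (q (i (T u))) = 0
        rw [this, map_zero]
      rw [h3] at h2
      simpa using h2.norm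
    simpa using (tendsto_finsetSum Finset.univ fun l _ => h1 l).mul_const (∑ l, ‖e l‖)
  filter_upwards [hL, eventually_ge_atTop N₀] with N hN hNN
  have hdec : i.comp ((colOp p y).comp ((projFin 𝕜 p N₀).comp A)) -
      B.comp ((trunc 𝕜 p N).comp A) =
      -(B'.comp ((trunc 𝕜 p N).comp A - (trunc 𝕜 p N₀).comp A)) +
        -((B₂.comp (projFin 𝕜 p N₀)).comp ((trunc 𝕜 p N₀).comp A)) +
        -(∑ l, ((e' l).comp (q.comp (B.comp ((trunc 𝕜 p N).comp A)))).smulRight (e l)) := by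
    ext1 u
    have h1 : projFin 𝕜 p N₀ (trunc 𝕜 p N₀ (A u)) = projFin 𝕜 p N₀ (A u) := by
      rw [← inclFin_comp_projFin, ContinuousLinearMap.comp_apply, projFin_inclFin]
    have h2 : inclFin 𝕜 p N₀ (projFin 𝕜 p N₀ (A u)) = trunc 𝕜 p N₀ (A u) := by
      rw [← inclFin_comp_projFin, ContinuousLinearMap.comp_apply]
    have h3 : B' (trunc 𝕜 p N (A u)) = B (trunc 𝕜 p N (A u)) - L (B (trunc 𝕜 p N (A u))) := rfl
    have h4 : (∑ l, ((e' l).comp (q.comp (B.comp ((trunc 𝕜 p N).comp A)))).smulRight (e l)) u =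
        L (B (trunc 𝕜 p N (A u))) := by
      simp only [L, _root_.sum_apply]
      rfl
    simp only [_root_.add_apply, _root_.neg_apply, _root_.sub_apply, h4,
      ContinuousLinearMap.comp_apply, hcol, V, h1, h2, map_sub, h3]
    abel
  rw [hdec]
  have hf1 : FinFactors p (B'.comp ((trunc 𝕜 p N).comp A - (trunc 𝕜 p N₀).comp A)) c := by
    refine finFactors_of_mul_le (N := N) ((supportedBelow_trunc_comp A N).sub
      ((supportedBelow_trunc_comp A N₀).mono hNN)) hc0 ?_
    have h1 := hN₀ N hNN
    rw [dist_eq_norm, lt_div_iff₀ (by positivity)] at h1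
    refine le_trans ?_ h1.le
    gcongr
    linarith
  have hf2 : FinFactors p ((B₂.comp (projFin 𝕜 p N₀)).comp ((trunc 𝕜 p N₀).comp A)) c := by
    refine finFactors_of_mul_le (supportedBelow_trunc_comp A N₀) hc0 ?_
    calc _ ≤ (‖A‖ + 1) * (5 * β) := by
          gcongr
          · exact (opNorm_comp_le_right (norm_trunc_le _) _).trans (by linarith)
          · exact (norm_comp_projFin_le _).trans hB₂
      _ = c * c := by
          rw [hβ]
          field_simp
  exact ((hf1.neg.add hf2.neg).add hN.neg).mono (by linarith)

end Approximation

/-! ### The quotient of `Y**` by `Y` -/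

section Quotient

variable {𝕜 : Type*} [RCLike 𝕜]
variable {Z : Type*} [NormedAddCommGroup Z] [NormedSpace 𝕜 Z]

lemma norm_liftQL_le (V : Submodule 𝕜 Z) [IsClosed (V : Set Z)] (f : Dual 𝕜 Z)
    (hf : V ≤ LinearMap.ker (f : Z →ₗ[𝕜] 𝕜)) (e : Z ⧸ V) :
    ‖V.liftQ (f : Z →ₗ[𝕜] 𝕜) hf e‖ ≤ ‖f‖ * ‖e‖ := by
  refine le_of_forall_pos_le_add fun ε hε => ?_
  obtain ⟨z, rfl, hz⟩ := Submodule.Quotient.norm_mk_lt e (show 0 < ε / (‖f‖ + 1) by positivity)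
  rw [Submodule.liftQ_apply]
  refine (f.le_opNorm z).trans ?_
  calc ‖f‖ * ‖z‖ ≤ ‖f‖ * (‖(Submodule.Quotient.mk z : Z ⧸ V)‖ + ε / (‖f‖ + 1)) := by gcongr
    _ = ‖f‖ * ‖(Submodule.Quotient.mk z : Z ⧸ V)‖ + ‖f‖ / (‖f‖ + 1) * ε := by ring
    _ ≤ _ := by
      gcongr
      refine mul_le_of_le_one_left hε.le ?_
      rw [div_le_one (by positivity)]
      linarith

/-- A projection of the dual of `Z` onto the annihilator of `V`, read as an operator into the dual
of the quotient by `V`. -/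
lemma exists_dual_quotient_retraction (V : Submodule 𝕜 Z) [IsClosed (V : Set Z)]
    (P : Dual 𝕜 Z →L[𝕜] Dual 𝕜 Z) (hP : ∀ φ, ∀ z ∈ V, P φ z = 0)
    (hPV : ∀ φ : Dual 𝕜 Z, (∀ z ∈ V, φ z = 0) → P φ = φ) :
    ∃ r : Dual 𝕜 Z →L[𝕜] Dual 𝕜 (Z ⧸ V), ∀ g : Dual 𝕜 (Z ⧸ V), r (g.comp V.mkQL) = g := by
  have hle : ∀ φ, V ≤ LinearMap.ker (P φ : Z →ₗ[𝕜] 𝕜) := fun φ z hz => hP φ z hz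
  let r₀ : Dual 𝕜 Z →ₗ[𝕜] Dual 𝕜 (Z ⧸ V) :=
    { toFun := fun φ => LinearMap.mkContinuous (V.liftQ (P φ : Z →ₗ[𝕜] 𝕜) (hle φ)) ‖P φ‖
        (norm_liftQL_le V (P φ) (hle φ))
      map_add' := fun φ χ => by
        ext e
        obtain ⟨z, rfl⟩ := V.mkQ_surjective e
        change P (φ + χ) z = P φ z + P χ z
        rw [map_add]
        rfl
      map_smul' := fun c φ => by
        ext e
        obtain ⟨z, rfl⟩ := V.mkQ_surjective e
        change P (c • φ) z = c • P φ z
        rw [map_smul]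
        rfl }
  refine ⟨r₀.mkContinuous ‖P‖ fun φ => ?_, fun g => ?_⟩
  · exact (LinearMap.mkContinuous_norm_le _ (norm_nonneg _) (norm_liftQL_le V (P φ) (hle φ))).trans (P.le_opNorm φ)
  · ext e
    obtain ⟨z, rfl⟩ := V.mkQ_surjective e
    change P (g.comp V.mkQL) z = g (V.mkQ z)
    rw [hPV]
    · rfl
    · intro w hw
      change g (V.mkQ w) = 0
      rw [Submodule.mkQ_apply, (Submodule.Quotient.mk_eq_zero V).2 hw, map_zero]

lemma HasAP.of_dual_quotient {V : Submodule 𝕜 Z} [IsClosed (V : Set Z)] (h : HasAP 𝕜 (Dual 𝕜 Z))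
    (r : Dual 𝕜 Z →L[𝕜] Dual 𝕜 (Z ⧸ V)) (hr : ∀ g : Dual 𝕜 (Z ⧸ V), r (g.comp V.mkQL) = g) :
    HasAP 𝕜 (Z ⧸ V) :=
  HasAP.of_dual (h.of_retract (adj V.mkQL) r hr)

variable (𝕜) in
-- `id - π_{Y*} (π_Y)*` projects `Y***` onto the annihilator of `π_Y Y`, which is the dual of the
-- quotient.
lemma exists_retraction_bidual (Y : Type*) [NormedAddCommGroup Y] [NormedSpace 𝕜 Y]
    (V : Submodule 𝕜 (Dual 𝕜 (Dual 𝕜 Y))) (hV : ∀ z, z ∈ V ↔ ∃ y, incl 𝕜 Y y = z)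
    [IsClosed (V : Set (Dual 𝕜 (Dual 𝕜 Y)))] :
    ∃ r : Dual 𝕜 (Dual 𝕜 (Dual 𝕜 Y)) →L[𝕜] Dual 𝕜 (Dual 𝕜 (Dual 𝕜 Y) ⧸ V),
      ∀ g : Dual 𝕜 (Dual 𝕜 (Dual 𝕜 Y) ⧸ V), r (g.comp V.mkQL) = g := by
  refine exists_dual_quotient_retraction V
    (ContinuousLinearMap.id 𝕜 _ - (incl 𝕜 (Dual 𝕜 Y)).comp (adj (incl 𝕜 Y)))
    (fun φ z hz => ?_) (fun φ hφ => ?_)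
  · obtain ⟨y, rfl⟩ := (hV z).1 hz
    change φ (incl 𝕜 Y y) - φ (incl 𝕜 Y y) = 0
    rw [sub_self]
  · have h1 : adj (incl 𝕜 Y) φ = 0 := by
      ext y
      exact hφ _ ((hV _).2 ⟨y, rfl⟩)
    rw [_root_.sub_apply, ContinuousLinearMap.comp_apply, h1, map_zero, sub_zero]
    rfl

end Quotient

/-! ### Descent from `Y**` to `Y` -/

section Main

variable {𝕜 : Type*} [RCLike 𝕜] {p : ℝ≥0∞} [hp1 : Fact (1 ≤ p)]
variable {X : Type*} [NormedAddCommGroup X] [NormedSpace 𝕜 X]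
variable {Y : Type*} [NormedAddCommGroup Y] [NormedSpace 𝕜 Y] [CompleteSpace Y]

theorem exists_finiteRank_approx_of_tridual
    (hAP : HasAP 𝕜 (Dual 𝕜 (Dual 𝕜 (Dual 𝕜 Y)))) {T : X →L[𝕜] Y}
    {A : X →L[𝕜] lp (fun _ : ℕ => 𝕜) p} {B : lp (fun _ : ℕ => 𝕜) p →L[𝕜] Dual 𝕜 (Dual 𝕜 Y)}
    (hT : (incl 𝕜 Y).comp T = B.comp A)
    (hA : Tendsto (fun N => (trunc 𝕜 p N).comp A) atTop (𝓝 A))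
    (hB : Tendsto (fun N => B.comp (trunc 𝕜 p N)) atTop (𝓝 B)) {ε : ℝ} (hε : 0 < ε) :
    ∃ S : X →L[𝕜] Y, IsFiniteRank S ∧
      ∀ᶠ N in atTop, FinFactors p ((incl 𝕜 Y).comp S - B.comp ((trunc 𝕜 p N).comp A)) ε := by
  let V : Submodule 𝕜 (Dual 𝕜 (Dual 𝕜 Y)) :=
    LinearMap.range (incl 𝕜 Y : Y →ₗ[𝕜] Dual 𝕜 (Dual 𝕜 Y))
  have hV : ∀ z, z ∈ V ↔ ∃ y, incl 𝕜 Y y = z := fun z => Iff.rfl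
  have : IsClosed (V : Set (Dual 𝕜 (Dual 𝕜 Y))) := isClosed_range_incl
  clear_value V
  obtain ⟨r, hr⟩ := exists_retraction_bidual 𝕜 Y V hV
  have hE : HasAP 𝕜 (Dual 𝕜 (Dual 𝕜 Y) ⧸ V) := hAP.of_dual_quotient r hr
  refine exists_finiteRank_approx_of_lift hE (incl 𝕜 Y) V.mkQL (fun z => ?_) V.mkQ_surjective
    (norm_nonneg r) (fun N D β hβ hD => ?_) hT hA hB hε
  · rw [← hV]
    exact Submodule.Quotient.mk_eq_zero V
  · refine exists_colOp_lift V.mkQL (fun e η h => ?_) r hr D hβ hD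
    obtain ⟨z, hz, hlt⟩ := Submodule.Quotient.norm_mk_lt e (sub_pos.2 h)
    exact ⟨z, hz, by linarith⟩

omit [CompleteSpace Y] in
lemma norm_le_norm_comp {Z W : Type*} [NormedAddCommGroup Z] [NormedSpace 𝕜 Z]
    [NormedAddCommGroup W] [NormedSpace 𝕜 W] (i : Y →L[𝕜] W) (hi : ∀ y, ‖i y‖ = ‖y‖)
    (S : Z →L[𝕜] Y) : ‖S‖ ≤ ‖i.comp S‖ := by
  refine ContinuousLinearMap.opNorm_le_bound _ (norm_nonneg _) fun z => ?_
  rw [← hi (S z)]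
  exact (i.comp S).le_opNorm z

lemma norm_sub_le_of_eventually {V : Type*} [NormedAddCommGroup V] {u : ℕ → V} {a b : V} {c : ℝ}
    (hu : Tendsto u atTop (𝓝 b)) (h : ∀ᶠ n in atTop, ‖a - u n‖ ≤ c) : ‖a - b‖ ≤ c :=
  le_of_tendsto (tendsto_const_nhds.sub hu).norm h

omit [CompleteSpace Y] in
lemma FinFactors.incl_comp_sub {S S' : X →L[𝕜] Y} {U : X →L[𝕜] Dual 𝕜 (Dual 𝕜 Y)} {c c' : ℝ}
    (hS : FinFactors p ((incl 𝕜 Y).comp S - U) c) (hS' : FinFactors p ((incl 𝕜 Y).comp S' - U) c') :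
    FinFactors p ((incl 𝕜 Y).comp (S' - S)) (c' + c) := by
  have h1 := hS'.add hS.neg
  have h2 : (incl 𝕜 Y).comp (S' - S) =
      ((incl 𝕜 Y).comp S' - U) + -((incl 𝕜 Y).comp S - U) := by
    rw [ContinuousLinearMap.comp_sub]
    abel
  rw [h2]
  exact h1

/-- `S k` and `S (k + 1)` are both compared with `U N` for one large `N`, so in `Y**` their
difference factors with constant `2 * 2^-k`. Local reflexivity brings this down to `Y` with `10 *
2^-k`, hence `C + 10`. -/
theorem approxFactors_of_finiteRank_approx {T : X →L[𝕜] Y}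
    {U : ℕ → X →L[𝕜] Dual 𝕜 (Dual 𝕜 Y)} (hU : Tendsto U atTop (𝓝 ((incl 𝕜 Y).comp T)))
    (h : ∀ ε : ℝ, 0 < ε → ∃ S : X →L[𝕜] Y, IsFiniteRank S ∧
      ∀ᶠ N in atTop, FinFactors p ((incl 𝕜 Y).comp S - U N) ε) : ApproxFactors p T := by
  choose S hS hSU using fun k : ℕ => h ((1 / 2) ^ k) (by positivity)
  obtain ⟨C, hC0, hC⟩ := (hS 0).finFactors (p := p)
  refine approxFactors_of_tendsto (S := S) (C := C + 10) (hC.mono (by linarith)) (fun k => ?_) ?_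
  · obtain ⟨N, hN, hN'⟩ := ((hSU k).and (hSU (k + 1))).exists
    have hpos : (0 : ℝ) < (1 / 2) ^ k := by positivity
    have h1 : FinFactors p ((incl 𝕜 Y).comp (S (k + 1) - S k)) (2 * (1 / 2) ^ k) :=
      (hN.incl_comp_sub hN').mono (by rw [pow_succ]; linarith)
    exact (h1.of_incl_comp (by positivity)).mono (by nlinarith)
  · have hle : ∀ k, ‖S k - T‖ ≤ (1 / 2) ^ k * (1 / 2) ^ k := fun k => by
      refine (norm_le_norm_comp (incl 𝕜 Y) norm_incl (S k - T)).trans ?_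
      rw [ContinuousLinearMap.comp_sub]
      exact norm_sub_le_of_eventually (V := X →L[𝕜] Dual 𝕜 (Dual 𝕜 Y)) hU
        ((hSU k).mono fun N hN => hN.norm_le)
    rw [tendsto_iff_norm_sub_tendsto_zero]
    refine squeeze_zero (fun _ => norm_nonneg _) hle ?_
    have h2 := tendsto_pow_atTop_nhds_zero_of_lt_one (r := (1 / 2 : ℝ)) (by norm_num) (by norm_num)
    simpa using h2.mul h2

theorem approxFactors_of_incl_comp
    (hAP : HasAP 𝕜 (Dual 𝕜 X) ∨ HasAP 𝕜 (Dual 𝕜 (Dual 𝕜 (Dual 𝕜 Y)))) {T : X →L[𝕜] Y}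
    (h : ApproxFactors p ((incl 𝕜 Y).comp T)) : ApproxFactors p T := by
  obtain ⟨A, B, hT, hA, hB⟩ := h
  have hU := tendsto_comp_trunc_comp B hA
  rw [← hT] at hU
  refine approxFactors_of_finiteRank_approx hU fun ε hε => ?_
  rcases hAP with hAP | hAP
  · exact exists_finiteRank_approx_of_dual hAP hT hA hε
  · exact exists_finiteRank_approx_of_tridual hAP hT hA hB hε

end Main

end LpFactor

end

theorem theorem1 {𝕜 : Type*} [RCLike 𝕜] (p : ℝ≥0∞) [Fact (1 ≤ p)]
    {X : Type*} [NormedAddCommGroup X] [NormedSpace 𝕜 X] [CompleteSpace X]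
    {Y : Type*} [NormedAddCommGroup Y] [NormedSpace 𝕜 Y] [CompleteSpace Y] :
    (∀ T : X →L[𝕜] Y,
      LpFactor.FactorsCompactly p ((LpFactor.incl 𝕜 Y).comp T) ↔
        LpFactor.FactorsCompactly p (LpFactor.biadj T)) ∧
    (LpFactor.HasAP 𝕜 (LpFactor.Dual 𝕜 X) ∨
        LpFactor.HasAP 𝕜 (LpFactor.Dual 𝕜 (LpFactor.Dual 𝕜 (LpFactor.Dual 𝕜 Y))) →
      (∀ T : X →L[𝕜] Y,
        LpFactor.FactorsCompactly p (LpFactor.biadj T) → LpFactor.FactorsCompactly p T) ∧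
      (∀ T : X →L[𝕜] Y,
        LpFactor.FactorsCompactly p ((LpFactor.incl 𝕜 Y).comp T) →
          LpFactor.FactorsCompactly p T) ∧
      LpFactor.KpReg 𝕜 p X Y = LpFactor.Kp 𝕜 p X Y) := by
  refine ⟨fun T => ⟨LpFactor.factorsCompactly_biadj_of_incl_comp,
    LpFactor.factorsCompactly_incl_comp_of_biadj⟩, fun hAP => ?_⟩
  have hreg : ∀ T : X →L[𝕜] Y, LpFactor.FactorsCompactly p ((LpFactor.incl 𝕜 Y).comp T) →
      LpFactor.FactorsCompactly p T := fun T h =>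
    (LpFactor.approxFactors_of_incl_comp hAP h.approxFactors).factorsCompactly
  refine ⟨fun T h => hreg T (LpFactor.factorsCompactly_incl_comp_of_biadj h), hreg,
    Set.Subset.antisymm (fun T hT => ?_) fun T hT => ?_⟩
  · exact (LpFactor.approxFactors_of_incl_comp hAP (LpFactor.approxFactors_of_mem_Kp hT)).mem_Kp
  · exact ((LpFactor.approxFactors_of_mem_Kp hT).clm_comp _).mem_Kp
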